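/- There are universal constants $c, K > 0$ such that the following holds for every dimension $d \ge 1$, every Borel probability measure $\pi$ on $\mathbb{R}^d$, and all reals $q \ge 1$, $C > 0$, $M > 0$, $\beta \in (0,1]$; write $|\cdot|$ for the Euclidean norm and $x_{-k} \in \mathbb{R}^{d-1}$ for $x$ without its $k$-th coordinate. Suppose that $\pi$ satisfies the $L^q$-Poincaré inequality with constant $C$: for every locally Lipschitz, $\pi$-integrable $f:\mathbb{R}^d\to\mathbb{R}$, $$\mathbb{E}_\pi\big[|f-\mathbb{E}_\pi f|^q\big] \le \frac1C\,\mathbb{E}_\pi\big[|\nabla f|^q\big],$$ where $|\nabla f|(x)$ is the local Lipschitz constant $\limsup_{y\to x}|f(y)-f(x)|/|y-x|$ at the points where $f$ is not differentiable. Let $\pi(\cdot\mid x_{-k})$, for $k = 1,\dots,d$ and $x\in\mathbb{R}^d$, be a regular conditional distribution of $X_k$ given $X_{-k}=x_{-k}$, where $X\sim\pi$, and suppose that these are $(M,\beta)$-TV continuous: $$\|\pi(\cdot\mid x_{-k})-\pi(\cdot\mid y_{-k})\|_{TV}\le M\,|x_{-k}-y_{-k}|^\beta\qquad\text{for all } k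 \text{ and all } x,y\in\mathbb{R}^d,$$ where $\|\mu-\nu\|_{TV}=\sup_S|\mu(S)-\nu(S)|$ over measurable $S$. Let $P_{SS}=P_dP_{d-1}\cdots P_1$ be the systematic-scan Gibbs kernel, which updates the coordinates $1,\dots,d$ in this order, $P_k$ resampling the $k$-th coordinate from $\pi(\cdot\mid x_{-k})$ and leaving the others unchanged. Then its conductance satisfies $$\Phi(P_{SS}) := \inf\Big\{\frac{\int_S P_{SS}(x,S^c)\,\pi(dx)}{\pi(S)} : S \text{ measurable},\ 0<\pi(S)\le\tfrac12\Big\}\ \ge\ c\,\min\Big\{1,\frac{C}{(Md)^{q/\beta}}\Big\}.$$ Moreover, let $\Omega>0$, let $\mu$ be a Borel probability measure on $\mathbb{R}^d$ that is an $\Omega$-warm start, i.e. $\sup_S \mu(S)/\pi(S)\le\Omega$ over measurable $S$ (with $0/0=0$ and $a/0=\infty$ for $a>0$), and let $0<\zeta\le\sqrt\Omega$. Then the $\zeta$-mixing time of the chain started from $\mu$ satisfies $$\tau(\zeta,P_{SS}) := \inf\{n\ge0 : \|\mu P_{SS}^n-\pi\|_{TV}\le\zeta\}\ \le\ K\,\max\Big\{1,\frac{(Md)^{2q/\beta}}{C^2}\Big\}\,\log\Big(\frac{\sqrt\Omega}{\zeta}\Big).$$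 -/

import Mathlib

open MeasureTheory ProbabilityTheory Filter Topology
open scoped ENNReal NNReal

namespace GibbsSampler

noncomputable section

/-- The state space `ℝ^d` with its Euclidean norm and Borel σ-algebra. -/
abbrev Space (d : ℕ) : Type := EuclideanSpace ℝ (Fin d)

/-- The space `ℝ^(d-1)` of the vectors `x_{-k}`, with its Euclidean norm. -/
abbrev SpaceDrop {d : ℕ} (k : Fin d) : Type := EuclideanSpace ℝ {j : Fin d // j ≠ k}

/-- `x_{-k}`: the vector `x` without its `k`-th coordinate. -/
def dropCoord {d : ℕ} (k : Fin d) (x : Space d) : SpaceDrop k :=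
  WithLp.toLp 2 (fun j => x j.1)

/-- `(x_{-k}, t)`: the vector `x` with its `k`-th coordinate replaced by `t`. -/
def setCoord {d : ℕ} (k : Fin d) (x : Space d) (t : ℝ) : Space d :=
  WithLp.toLp 2 (fun j => if j = k then t else x j)

theorem measurable_dropCoord {d : ℕ} (k : Fin d) : Measurable (dropCoord k) := by
  have : Continuous (dropCoord k) := by
    unfold dropCoord
    fun_prop
  exact this.measurable

theorem measurable_setCoord {d : ℕ} (k : Fin d) :
    Measurable (fun p : Space d × ℝ => setCoord k p.1 p.2) := by
  have : Continuous (fun p : Space d × ℝ => setCoord k p.1 p.2) := by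
    unfold setCoord
    refine (PiLp.continuous_toLp 2 _).comp (continuous_pi fun j => ?_)
    by_cases h : j = k
    · simpa [h] using continuous_snd
    · simp only [h, if_false]
      fun_prop
  exact this.measurable

/-- `|∇f|(x)`: the Euclidean norm of the gradient wherever `f` is differentiable, and the local
Lipschitz constant `limsup_{y → x} |f y - f x| / |y - x|` at the remaining points (a Lebesgue-null
set when `f` is locally Lipschitz). -/
def gradNorm {d : ℕ} (f : Space d → ℝ) (x : Space d) : ℝ≥0∞ :=
  open Classical in
  if DifferentiableAt ℝ f x then ‖gradient f x‖ₑ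
  else limsup (fun y => ‖f y - f x‖ₑ / ‖y - x‖ₑ) (𝓝[≠] x)

/-- The `L^q`-Poincaré inequality with constant `C`:
`E|f - E f|^q ≤ C⁻¹ E|∇f|^q` for all locally Lipschitz `f` whose mean is defined. Both sides may be
infinite. -/
def PoincareInequality {d : ℕ} (π : Measure (Space d)) (q C : ℝ) : Prop :=
  ∀ f : Space d → ℝ, LocallyLipschitz f → Integrable f π →
    ∫⁻ x, ‖f x - ∫ y, f y ∂π‖ₑ ^ q ∂π ≤ (ENNReal.ofReal C)⁻¹ * ∫⁻ x, gradNorm f x ^ q ∂π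

/-- Total variation distance `sup_S |μ S - ν S|` of two finite measures. -/
def tvDist {α : Type*} [MeasurableSpace α] (μ ν : Measure α) : ℝ :=
  ⨆ S : {S : Set α // MeasurableSet S}, |μ.real S.1 - ν.real S.1|

/-- `κ k s` is the conditional distribution `π(· ∣ x_{-k} = s)` of the `k`-th coordinate given the
other ones, for every `k`. -/
def IsConditionalFamily {d : ℕ} (π : Measure (Space d))
    (κ : (k : Fin d) → Kernel (SpaceDrop k) ℝ) : Prop :=
  ∀ k, HasCondDistrib (fun x : Space d => x k) (dropCoord k) (κ k) π

/-- The conditional distributions `κ` are `(M, β)`-TV continuous. -/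
def TVContinuous {d : ℕ} (κ : (k : Fin d) → Kernel (SpaceDrop k) ℝ) (M β : ℝ) : Prop :=
  ∀ k, ∀ x y : Space d, tvDist (κ k (dropCoord k x)) (κ k (dropCoord k y)) ≤
    M * ‖dropCoord k x - dropCoord k y‖ ^ β

/-- The kernel `P_k`, which resamples the `k`-th coordinate from its conditional distribution given
the other coordinates, and leaves these unchanged. -/
def gibbsStep {d : ℕ} (κ : (k : Fin d) → Kernel (SpaceDrop k) ℝ) (k : Fin d) :
    Kernel (Space d) (Space d) :=
  (Kernel.id ×ₖ (κ k).comap (dropCoord k) (measurable_dropCoord k)).map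
    (fun p : Space d × ℝ => setCoord k p.1 p.2)

/-- The systematic-scan Gibbs kernel `P_SS = P_d P_{d-1} ⋯ P_1`. The product of kernels is their
composition, in which the rightmost factor acts first: the coordinates are updated in increasing
order. -/
def systematicScan {d : ℕ} (κ : (k : Fin d) → Kernel (SpaceDrop k) ℝ) :
    Kernel (Space d) (Space d) :=
  (List.ofFn (gibbsStep κ)).reverse.prod

/-- The conductance of `P` with respect to `π`: the infimum of `∫_S P(x, Sᶜ) π(dx) / π(S)` over the
measurable sets `S` with `0 < π(S) ≤ 1/2`. -/
def conductance {α : Type*} [MeasurableSpace α] (π : Measure α) (P : Kernel α α) : ℝ≥0∞ :=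
  ⨅ (S : Set α) (_ : MeasurableSet S) (_ : 0 < π S) (_ : π S ≤ 1 / 2),
    (∫⁻ x in S, P x Sᶜ ∂π) / π S

/-- `μ` is an `Ω`-warm start for `π`: `sup_S μ(S) / π(S) ≤ Ω` (with `0 / 0 = 0` and `a / 0 = ∞` for
`a > 0`). -/
def IsWarmStart {α : Type*} [MeasurableSpace α] (π μ : Measure α) (Ω : ℝ) : Prop :=
  ⨆ (S : Set α) (_ : MeasurableSet S), μ S / π S ≤ ENNReal.ofReal Ω

/-- The `ζ`-mixing time `inf {n ≥ 0 : ‖μ P^n - π‖_TV ≤ ζ}` of the chain with kernel `P` and initial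
distribution `μ`; it is `∞` if there is no such `n`. -/
def mixingTime {α : Type*} [MeasurableSpace α] (π μ : Measure α) (P : Kernel α α) (ζ : ℝ) : ℕ∞ :=
  ⨅ (n : ℕ) (_ : tvDist ((P ^ n) ∘ₘ μ) π ≤ ζ), (n : ℕ∞)

end

end GibbsSampler

/-! Let `P` be the scan, `g = P 1_S` and `δ = (M d)^(-1/β)`. Everything reduces to bounding the flow
`E[g (1 - g)]` below by a universal multiple of `min(1, C δ^q) π(S)`
(`systematicScan_flow_lower_bound`). By stationarity this flow is at most twice the probability flux
from `S` to `Sᶜ`, whence the conductance. It is also the probability that two independent steps from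
a common state drawn from `π` land in `S` and in `Sᶜ`. The law of these two steps couples `π` with
itself, and its Dirichlet form is `2 (‖f‖² - ‖P f‖²)`, so Cheeger's inequality for it is an `L²`
contraction of `P`, with neither reversibility nor laziness (`integral_kernel_sq_le`).

For the flow bound, let `|x - y| ≤ 9δ/4`. Each of the `d` updates can be coupled with failure
probability at most `9/(4d)`, so `g` cannot be almost `1` at `x` and almost `0` at `y`
(`pow_le_scan_overlap`). The sets where `g` is almost `1` and almost `0` are therefore far apart,
and the Poincaré inequality for a cutoff between them puts much mass in the region where `g (1 - g)`
is bounded below (`isoperimetry`, `flow_lower_bound`).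

A constant factor lost in `δ` would be raised to the power `q`. So the cutoff has slope exactly
`1/δ` and height `2`, which needs a separation larger than `2δ`. For `d = 2` the failure bound
`9/(4d)` exceeds `1`; there the separation comes from two functions, each depending on one
coordinate only. -/

namespace GibbsSampler

/-! ### Bounded measurable functions and their integrals against Markov kernels. -/

section BoundedMeasurable

variable {α β : Type*} [MeasurableSpace α] [MeasurableSpace β]

/-- Bounded measurable real functions. -/
def IsBddMeas (f : α → ℝ) : Prop := Measurable f ∧ ∃ B, ∀ x, |f x| ≤ B

theorem IsBddMeas.integrable {f : α → ℝ} (hf : IsBddMeas f) (μ : Measure α) [IsFiniteMeasure μ] :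
    Integrable f μ := by
  obtain ⟨hm, B, hB⟩ := hf
  exact Integrable.of_bound hm.aestronglyMeasurable B (Eventually.of_forall hB)

theorem isBddMeas_const (c : ℝ) : IsBddMeas (fun _ : α => c) :=
  ⟨measurable_const, |c|, fun _ => le_rfl⟩

theorem IsBddMeas.add {f g : α → ℝ} (hf : IsBddMeas f) (hg : IsBddMeas g) :
    IsBddMeas (fun x => f x + g x) := by
  obtain ⟨hm, B, hB⟩ := hf
  obtain ⟨hm', B', hB'⟩ := hg
  exact ⟨hm.add hm', B + B', fun x => (abs_add_le _ _).trans (add_le_add (hB x) (hB' x))⟩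

theorem IsBddMeas.mul {f g : α → ℝ} (hf : IsBddMeas f) (hg : IsBddMeas g) :
    IsBddMeas (fun x => f x * g x) := by
  obtain ⟨hm, B, hB⟩ := hf
  obtain ⟨hm', B', hB'⟩ := hg
  refine ⟨hm.mul hm', B * B', fun x => ?_⟩
  rw [abs_mul]
  exact mul_le_mul (hB x) (hB' x) (abs_nonneg _) ((abs_nonneg _).trans (hB x))

theorem IsBddMeas.sub {f g : α → ℝ} (hf : IsBddMeas f) (hg : IsBddMeas g) :
    IsBddMeas (fun x => f x - g x) := by
  simpa [sub_eq_add_neg] using hf.add ((isBddMeas_const (-1)).mul hg)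

theorem IsBddMeas.pow {f : α → ℝ} (hf : IsBddMeas f) (n : ℕ) : IsBddMeas (fun x => f x ^ n) := by
  induction n with
  | zero => simpa using isBddMeas_const 1
  | succ n ih => simpa [pow_succ] using ih.mul hf

theorem IsBddMeas.abs {f : α → ℝ} (hf : IsBddMeas f) : IsBddMeas (fun x => |f x|) := by
  obtain ⟨hm, B, hB⟩ := hf
  exact ⟨hm.abs, B, fun x => by simpa using hB x⟩

theorem IsBddMeas.max_zero {f : α → ℝ} (hf : IsBddMeas f) : IsBddMeas (fun x => max (f x) 0) := by
  obtain ⟨hm, B, hB⟩ := hf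
  refine ⟨hm.max measurable_const, B, fun x => ?_⟩
  rw [abs_of_nonneg (le_max_right _ _)]
  exact max_le ((le_abs_self _).trans (hB x)) ((abs_nonneg _).trans (hB x))

theorem IsBddMeas.comp {f : β → ℝ} (hf : IsBddMeas f) {φ : α → β} (hφ : Measurable φ) :
    IsBddMeas (fun x => f (φ x)) :=
  ⟨hf.1.comp hφ, hf.2.imp fun _ h x => h (φ x)⟩

theorem isBddMeas_indicator {S : Set α} (hS : MeasurableSet S) :
    IsBddMeas (S.indicator (fun _ => (1 : ℝ))) :=
  ⟨measurable_const.indicator hS, 1, fun x => by by_cases h : x ∈ S <;> simp [h]⟩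

theorem IsBddMeas.of_mem_Icc {f : α → ℝ} (hf : Measurable f) (h : ∀ x, f x ∈ Set.Icc (0 : ℝ) 1) :
    IsBddMeas f := ⟨hf, 1, fun x => by rw [abs_of_nonneg (h x).1]; exact (h x).2⟩

theorem IsBddMeas.integral_kernel {f : β → ℝ} (hf : IsBddMeas f) (κ : Kernel α β)
    [IsMarkovKernel κ] : IsBddMeas (fun x => ∫ y, f y ∂κ x) := by
  have hi := fun x => hf.integrable (κ x)
  obtain ⟨hm, B, hB⟩ := hf
  refine ⟨(hm.stronglyMeasurable.integral_kernel (κ := κ)).measurable, B, fun x => ?_⟩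
  have := norm_integral_le_of_norm_le_const (μ := κ x) (f := f) (C := B)
    (Eventually.of_forall hB)
  simpa using this

theorem integral_kernel_mem_Icc {f : β → ℝ} (hf : Measurable f)
    (h : ∀ x, f x ∈ Set.Icc (0 : ℝ) 1) (ν : Measure β) [IsProbabilityMeasure ν] :
    ∫ y, f y ∂ν ∈ Set.Icc (0 : ℝ) 1 := by
  refine ⟨integral_nonneg fun x => (h x).1, ?_⟩
  calc ∫ y, f y ∂ν ≤ ∫ _, 1 ∂ν :=
        integral_mono ((IsBddMeas.of_mem_Icc hf h).integrable ν) (integrable_const _)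
          fun x => (h x).2
    _ = 1 := by simp

theorem integral_measure_comp (μ : Measure α) [IsFiniteMeasure μ] (κ : Kernel α β)
    [IsMarkovKernel κ] {f : β → ℝ} (hf : IsBddMeas f) :
    ∫ y, f y ∂(κ ∘ₘ μ) = ∫ x, ∫ y, f y ∂κ x ∂μ := by
  rw [Measure.comp_eq_comp_const_apply, Kernel.integral_comp]
  · simp
  · exact hf.integrable _

theorem integral_kernel_comp {γ : Type*} [MeasurableSpace γ] (κ : Kernel α β) (η : Kernel β γ)
    [IsMarkovKernel κ] [IsMarkovKernel η] {f : γ → ℝ} (hf : IsBddMeas f) (x : α) :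
    ∫ z, f z ∂((η ∘ₖ κ) x) = ∫ y, ∫ z, f z ∂η y ∂κ x :=
  Kernel.integral_comp (hf.integrable _)

end BoundedMeasurable

/-! ### Splitting off one coordinate. -/

section Coordinates

variable {d : ℕ}

theorem setCoord_eq_iff (k : Fin d) (x y : Space d) (t : ℝ)
    (h : dropCoord k x = dropCoord k y) : setCoord k x t = setCoord k y t := by
  ext j
  by_cases hj : j = k
  · simp [setCoord, hj]
  · have := congrArg (fun z : SpaceDrop k => z ⟨j, hj⟩) h
    simpa [setCoord, dropCoord, hj] using this

@[simp] theorem dropCoord_setCoord (k : Fin d) (x : Space d) (t : ℝ) :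
    dropCoord k (setCoord k x t) = dropCoord k x := by
  ext ⟨j, hj⟩
  simp [setCoord, dropCoord, hj]

@[simp] theorem setCoord_self (k : Fin d) (x : Space d) : setCoord k x (x k) = x := by
  ext j
  by_cases hj : j = k
  · subst hj; simp [setCoord]
  · simp [setCoord, hj]

/-- The vector with `k`-th coordinate `t` and the other coordinates given by `s`. -/
noncomputable def joinCoord (k : Fin d) (s : SpaceDrop k) (t : ℝ) : Space d :=
  WithLp.toLp 2 (fun j => if h : j = k then t else s ⟨j, h⟩)

theorem joinCoord_dropCoord (k : Fin d) (x : Space d) (t : ℝ) :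
    joinCoord k (dropCoord k x) t = setCoord k x t := by
  ext j
  by_cases hj : j = k <;> simp [joinCoord, setCoord, dropCoord, hj]

theorem measurable_joinCoord (k : Fin d) :
    Measurable (fun p : SpaceDrop k × ℝ => joinCoord k p.1 p.2) := by
  have : Continuous (fun p : SpaceDrop k × ℝ => joinCoord k p.1 p.2) := by
    unfold joinCoord
    refine (PiLp.continuous_toLp 2 _).comp (continuous_pi fun j => ?_)
    by_cases h : j = k
    · simpa [h] using continuous_snd
    · simp only [h, dif_neg, not_false_eq_true]
      fun_prop
  exact this.measurable

end Coordinates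

/-! ### Gibbs steps and scans: self-adjointness and invariance of `π`. -/

section Step

variable {d : ℕ} (κ : (k : Fin d) → Kernel (SpaceDrop k) ℝ)

theorem isMarkovKernel_gibbsStep [∀ k, IsMarkovKernel (κ k)] (k : Fin d) :
    IsMarkovKernel (gibbsStep κ k) := by
  unfold gibbsStep
  exact Kernel.IsMarkovKernel.map _ (measurable_setCoord k)

theorem gibbsStep_apply [∀ k, IsMarkovKernel (κ k)] (k : Fin d) (x : Space d) :
    gibbsStep κ k x = (κ k (dropCoord k x)).map (setCoord k x) := by
  have hm : Measurable (setCoord k x) := (measurable_setCoord k).comp measurable_prodMk_left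
  ext s hs
  rw [gibbsStep, Kernel.map_apply' _ (measurable_setCoord k) _ hs, Kernel.id_prod_apply' _ _
    (measurable_setCoord k hs), Kernel.comap_apply, Measure.map_apply hm hs]
  rfl

theorem integral_gibbsStep [∀ k, IsMarkovKernel (κ k)] (k : Fin d) (x : Space d)
    {f : Space d → ℝ} (hf : IsBddMeas f) :
    ∫ y, f y ∂gibbsStep κ k x = ∫ t, f (setCoord k x t) ∂κ k (dropCoord k x) := by
  have hm : Measurable (setCoord k x) := (measurable_setCoord k).comp measurable_prodMk_left
  rw [gibbsStep_apply, integral_map hm.aemeasurable hf.1.aestronglyMeasurable]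

/-- The kernel that updates the coordinates of the list `l` one after the other. -/
noncomputable def scan (l : List (Fin d)) : Kernel (Space d) (Space d) :=
  (l.map (gibbsStep κ)).reverse.prod

theorem systematicScan_eq_scan : systematicScan κ = scan κ (List.finRange d) := by
  rw [systematicScan, scan, List.ofFn_eq_map]

theorem scan_nil : scan κ [] = Kernel.id := rfl

theorem scan_cons (k : Fin d) (l : List (Fin d)) :
    scan κ (k :: l) = scan κ l ∘ₖ gibbsStep κ k := by
  simp only [scan, List.map_cons, List.reverse_cons, List.prod_append, List.prod_singleton]
  rfl

theorem isMarkovKernel_scan [∀ k, IsMarkovKernel (κ k)] (l : List (Fin d)) :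
    IsMarkovKernel (scan κ l) := by
  induction l with
  | nil => rw [scan_nil]; infer_instance
  | cons k l ih =>
    rw [scan_cons]
    have := isMarkovKernel_gibbsStep κ k
    infer_instance

theorem integral_scan_cons [∀ k, IsMarkovKernel (κ k)] (k : Fin d) (l : List (Fin d))
    {f : Space d → ℝ} (hf : IsBddMeas f) (x : Space d) :
    ∫ y, f y ∂scan κ (k :: l) x =
      ∫ t, (∫ y, f y ∂scan κ l (setCoord k x t)) ∂κ k (dropCoord k x) := by
  have := isMarkovKernel_gibbsStep κ k
  have := isMarkovKernel_scan κ l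
  rw [scan_cons, integral_kernel_comp _ _ hf, integral_gibbsStep _ _ _ (hf.integral_kernel _)]

/-- The Gibbs step is self-adjoint in `L²(π)`. -/
theorem integral_mul_gibbsStep_comm [∀ k, IsMarkovKernel (κ k)] {π : Measure (Space d)}
    [IsProbabilityMeasure π] (hκ : IsConditionalFamily π κ) (k : Fin d) {f g : Space d → ℝ}
    (hf : IsBddMeas f) (hg : IsBddMeas g) :
    ∫ x, f x * ∫ y, g y ∂gibbsStep κ k x ∂π = ∫ x, (∫ y, f y ∂gibbsStep κ k x) * g x ∂π := by
  have hlaw := (hκ k).map_eq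
  have hdm : Measurable (fun x : Space d => (dropCoord k x, x k)) :=
    (measurable_dropCoord k).prodMk (by fun_prop)
  have : IsProbabilityMeasure (π.map (dropCoord k)) :=
    Measure.isProbabilityMeasure_map (measurable_dropCoord k).aemeasurable
  have disint : ∀ h : SpaceDrop k × ℝ → ℝ, IsBddMeas h →
      ∫ x, h (dropCoord k x, x k) ∂π = ∫ s, ∫ t, h (s, t) ∂κ k s ∂(π.map (dropCoord k)) := by
    intro h hh
    rw [← Measure.integral_compProd (hh.integrable _), ← hlaw,
      integral_map hdm.aemeasurable hh.1.aestronglyMeasurable]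
  have hjoin : ∀ h : Space d → ℝ, IsBddMeas h →
      IsBddMeas (fun p : SpaceDrop k × ℝ => h (joinCoord k p.1 p.2)) :=
    fun h hh => hh.comp (measurable_joinCoord k)
  have havg : ∀ h : Space d → ℝ, IsBddMeas h →
      IsBddMeas (fun p : SpaceDrop k × ℝ => ∫ t, h (joinCoord k p.1 t) ∂κ k p.1) := by
    intro h hh
    refine IsBddMeas.comp (φ := Prod.fst)
      (f := fun s => ∫ t, h (joinCoord k s t) ∂κ k s) ⟨?_, ?_⟩ measurable_fst
    · exact ((hjoin h hh).1.stronglyMeasurable.integral_kernel_prod_right'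
        (κ := κ k)).measurable
    · obtain ⟨-, B, hB⟩ := hh
      refine ⟨B, fun s => ?_⟩
      have := norm_integral_le_of_norm_le_const (μ := κ k s)
        (f := fun t => h (joinCoord k s t)) (C := B) (Eventually.of_forall fun t => hB _)
      simpa using this
  -- After disintegration the inner average is constant in `t`, so both sides become the integral
  -- over `s` of the product of the conditional means of `f` and `g`.
  have h1 := disint _ ((hjoin f hf).mul (havg g hg))
  have h2 := disint _ ((havg f hf).mul (hjoin g hg))
  simp only [joinCoord_dropCoord, setCoord_self] at h1 h2
  simp only [integral_gibbsStep κ k _ hf, integral_gibbsStep κ k _ hg]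
  rw [h1, h2]
  simp only [integral_mul_const, integral_const_mul]

theorem integral_gibbsStep_invariant [∀ k, IsMarkovKernel (κ k)] {π : Measure (Space d)}
    [IsProbabilityMeasure π] (hκ : IsConditionalFamily π κ) (k : Fin d) {f : Space d → ℝ}
    (hf : IsBddMeas f) : ∫ x, (∫ y, f y ∂gibbsStep κ k x) ∂π = ∫ x, f x ∂π := by
  have := isMarkovKernel_gibbsStep κ k
  simpa using integral_mul_gibbsStep_comm κ hκ k (isBddMeas_const 1) hf

theorem integral_scan_invariant [∀ k, IsMarkovKernel (κ k)] {π : Measure (Space d)}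
    [IsProbabilityMeasure π] (hκ : IsConditionalFamily π κ) (l : List (Fin d)) {f : Space d → ℝ}
    (hf : IsBddMeas f) : ∫ x, (∫ y, f y ∂scan κ l x) ∂π = ∫ x, f x ∂π := by
  induction l with
  | nil => simp [scan_nil, Kernel.id_apply]
  | cons k l ih =>
    have := isMarkovKernel_gibbsStep κ k
    have := isMarkovKernel_scan κ l
    simp only [scan_cons, integral_kernel_comp _ _ hf]
    rw [integral_gibbsStep_invariant κ hκ k (hf.integral_kernel _), ih]

theorem scan_comp_measure [∀ k, IsMarkovKernel (κ k)] {π : Measure (Space d)}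
    [IsProbabilityMeasure π] (hκ : IsConditionalFamily π κ) (l : List (Fin d)) :
    scan κ l ∘ₘ π = π := by
  have := isMarkovKernel_scan κ l
  refine ext_of_forall_integral_eq_of_IsFiniteMeasure fun f => ?_
  have hf : IsBddMeas f := ⟨f.continuous.measurable, ‖f‖, fun x => f.norm_coe_le_norm x⟩
  rw [integral_measure_comp _ _ hf, integral_scan_invariant κ hκ l hf]

end Step

/-! ### Total variation and overlap of two measures. -/

section TotalVariation

variable {α : Type*} [MeasurableSpace α]

theorem abs_measureReal_sub_le_tvDist (μ ν : Measure α) [IsProbabilityMeasure μ]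
    [IsProbabilityMeasure ν] {S : Set α} (hS : MeasurableSet S) :
    |μ.real S - ν.real S| ≤ tvDist μ ν := by
  refine le_ciSup (f := fun S : {S : Set α // MeasurableSet S} => |μ.real S.1 - ν.real S.1|)
    ⟨1, ?_⟩ ⟨S, hS⟩
  rintro _ ⟨S, rfl⟩
  have h1 : μ.real S.1 ≤ 1 := measureReal_le_one
  have h2 : ν.real S.1 ≤ 1 := measureReal_le_one
  have h3 : 0 ≤ μ.real S.1 := measureReal_nonneg
  have h4 : 0 ≤ ν.real S.1 := measureReal_nonneg
  exact abs_le.2 ⟨by linarith, by linarith⟩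

/-- On the Hahn set where `ν ≤ μ` there is nothing to pay. On its complement `μ ≤ ν`; comparing the
integrals of `b - w` there leaves at most `b` times the excess of `ν`-mass. -/
theorem integral_le_add_tvDist (μ ν : Measure α) [IsProbabilityMeasure μ]
    [IsProbabilityMeasure ν] {w : α → ℝ} {b : ℝ} (hw : Measurable w) (h0 : ∀ x, 0 ≤ w x)
    (hb : ∀ x, w x ≤ b) : ∫ x, w x ∂ν ≤ ∫ x, w x ∂μ + b * tvDist μ ν := by
  have hwb : IsBddMeas w := ⟨hw, b, fun x => by rw [abs_of_nonneg (h0 x)]; exact hb x⟩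
  obtain ⟨x₀⟩ : Nonempty α := μ.nonempty_of_neZero
  have hb0 : 0 ≤ b := (h0 x₀).trans (hb x₀)
  obtain ⟨S, hS, h1, h2⟩ := hahn_decomposition (μ := μ) (ν := ν)
  have hle : ∀ (μ ν : Measure α) [IsProbabilityMeasure μ] [IsProbabilityMeasure ν]
      (T : Set α), MeasurableSet T → (∀ t, MeasurableSet t → t ⊆ T → ν t ≤ μ t) →
      ∀ u : α → ℝ, IsBddMeas u → (∀ x, 0 ≤ u x) → ∫ x in T, u x ∂ν ≤ ∫ x in T, u x ∂μ := by
    intro μ ν _ _ T hT h u hu hu0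
    refine integral_mono_measure ?_ (Eventually.of_forall hu0) (hu.integrable _)
    refine Measure.le_iff.2 fun s hs => ?_
    rw [Measure.restrict_apply hs, Measure.restrict_apply hs]
    exact h _ (hs.inter hT) Set.inter_subset_right
  have e1 := hle μ ν S hS h1 w hwb h0
  have e2 := hle ν μ Sᶜ hS.compl h2 (fun x => b - w x) ((isBddMeas_const b).sub hwb)
    fun x => sub_nonneg.2 (hb x)
  rw [integral_sub (integrable_const _) (hwb.integrable _),
    integral_sub (integrable_const _) (hwb.integrable _)] at e2
  simp only [integral_const, smul_eq_mul, MeasurableSet.univ, measureReal_restrict_apply,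
    Set.univ_inter] at e2
  have e3 := abs_le.1 (abs_measureReal_sub_le_tvDist μ ν hS.compl)
  have e4 := mul_le_mul_of_nonneg_left e3.1 hb0
  rw [← integral_add_compl hS (hwb.integrable μ), ← integral_add_compl hS (hwb.integrable ν)]
  linarith

/-- If `u + v ≥ b` pointwise, then `∫ u dμ + ∫ v dν ≥ b (1 - ‖μ - ν‖_TV)`. -/
theorem mul_one_sub_le_integral_add_integral (μ ν : Measure α) [IsProbabilityMeasure μ]
    [IsProbabilityMeasure ν] {u v : α → ℝ} {b t : ℝ} (hu : IsBddMeas u) (hv : IsBddMeas v)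
    (hu0 : ∀ x, 0 ≤ u x) (hv0 : ∀ x, 0 ≤ v x) (hb : 0 ≤ b) (h : ∀ x, b ≤ u x + v x)
    (ht : tvDist μ ν ≤ t) : b * (1 - t) ≤ ∫ x, u x ∂μ + ∫ x, v x ∂ν := by
  -- Truncation at `b` keeps `w ≤ u` and `b - w ≤ v`, and makes the cost of replacing `ν` by `μ` at
  -- most `b t`.
  set w : α → ℝ := fun x => min (u x) b with hwdef
  have hw : Measurable w := hu.1.min measurable_const
  have hw0 : ∀ x, 0 ≤ w x := fun x => le_min (hu0 x) hb
  have hwb : ∀ x, w x ≤ b := fun x => min_le_right _ _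
  have hwm : IsBddMeas w := ⟨hw, b, fun x => by rw [abs_of_nonneg (hw0 x)]; exact hwb x⟩
  have e1 := integral_le_add_tvDist μ ν hw hw0 hwb
  have e2 : ∫ x, w x ∂μ ≤ ∫ x, u x ∂μ :=
    integral_mono (hwm.integrable _) (hu.integrable _) fun x => min_le_left _ _
  have e3 : ∫ x, (b - w x) ∂ν ≤ ∫ x, v x ∂ν := by
    refine integral_mono (((isBddMeas_const b).sub hwm).integrable _) (hv.integrable _)
      fun x => ?_
    have h3 : w x = u x ∨ w x = b := by
      rcases le_total (u x) b with h | h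
      · exact Or.inl (min_eq_left h)
      · exact Or.inr (min_eq_right h)
    have := h x
    have := hv0 x
    show b - w x ≤ v x
    rcases h3 with h3 | h3 <;> rw [h3] <;> linarith
  rw [integral_sub (integrable_const _) (hwm.integrable _)] at e3
  simp only [integral_const, smul_eq_mul, probReal_univ, one_mul] at e3
  have := mul_le_mul_of_nonneg_left ht hb
  linarith

end TotalVariation

/-! ### Coupling two scans started at nearby states. -/

section Overlap

variable {d : ℕ} (κ : (k : Fin d) → Kernel (SpaceDrop k) ℝ) [∀ k, IsMarkovKernel (κ k)]

theorem norm_setCoord_sub_le (k : Fin d) (x y : Space d) (t : ℝ) :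
    ‖setCoord k x t - setCoord k y t‖ ≤ ‖x - y‖ := by
  rw [EuclideanSpace.norm_eq, EuclideanSpace.norm_eq]
  refine Real.sqrt_le_sqrt (Finset.sum_le_sum fun j _ => ?_)
  by_cases hj : j = k <;> simp [setCoord, hj, sq_nonneg]

theorem norm_dropCoord_sub_le (k : Fin d) (x y : Space d) :
    ‖dropCoord k x - dropCoord k y‖ ≤ ‖x - y‖ := by
  rw [EuclideanSpace.norm_eq, EuclideanSpace.norm_eq]
  refine Real.sqrt_le_sqrt ?_
  simp only [dropCoord, PiLp.sub_apply]
  rw [← Finset.sum_subtype (Finset.univ.filter (· ≠ k)) (by simp) (fun j => ‖x j - y j‖ ^ 2)]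
  exact Finset.sum_le_univ_sum_of_nonneg fun j => sq_nonneg _

/-- Two scans started from states that differ only in scanned coordinates overlap, since each
update can be coupled to agree with probability at least `1 - t`. -/
theorem pow_le_scan_overlap {r t : ℝ} (ht1 : t ≤ 1)
    (hTV : ∀ k, ∀ x y : Space d, ‖x - y‖ ≤ r →
      tvDist (κ k (dropCoord k x)) (κ k (dropCoord k y)) ≤ t)
    {f : Space d → ℝ} (hf : Measurable f) (hf01 : ∀ x, f x ∈ Set.Icc (0 : ℝ) 1)
    (l : List (Fin d)) (x y : Space d) (hxy : ‖x - y‖ ≤ r) (hl : ∀ j, j ∉ l → x j = y j) :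
    (1 - t) ^ l.length ≤ ∫ z, (1 - f z) ∂scan κ l x + ∫ z, f z ∂scan κ l y := by
  have hfb : IsBddMeas f := .of_mem_Icc hf hf01
  have hf'b : IsBddMeas (fun z => 1 - f z) := (isBddMeas_const 1).sub hfb
  induction l generalizing x y with
  | nil =>
    have : x = y := by
      ext j
      exact hl j (by simp)
    subst this
    simp [scan_nil, Kernel.id_apply]
  | cons k l ih =>
    have := isMarkovKernel_scan κ l
    have hset : ∀ x, Measurable (setCoord k x) := fun x =>
      (measurable_setCoord k).comp measurable_prodMk_left
    rw [integral_scan_cons κ k l hfb, integral_scan_cons κ k l hf'b, List.length_cons, pow_succ]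
    -- If both chains draw the same value `s`, they come to agree in coordinate `k` and move no
    -- further apart. The induction hypothesis then bounds the sum of the two integrands at `s`.
    refine mul_one_sub_le_integral_add_integral _ _ ((hf'b.integral_kernel _).comp (hset x))
      ((hfb.integral_kernel _).comp (hset y)) (fun s => ?_) (fun s => ?_)
      (pow_nonneg (by linarith) _) (fun s => ?_) (hTV k x y hxy)
    · exact integral_nonneg fun z => sub_nonneg.2 (hf01 z).2
    · exact integral_nonneg fun z => (hf01 z).1
    · refine ih _ _ ((norm_setCoord_sub_le k x y s).trans hxy) fun j hj => ?_
      by_cases hjk : j = k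
      · simp [setCoord, hjk]
      · simpa [setCoord, hjk] using hl j (by simp [hjk, hj])

/-- `P_k f` inherits the continuity of the conditional distributions if `f` does not depend on
the coordinates other than the `k`-th. -/
theorem integral_gibbsStep_sub_le (k : Fin d) (x y : Space d) {f : Space d → ℝ}
    (hf : Measurable f) (hf01 : ∀ x, f x ∈ Set.Icc (0 : ℝ) 1)
    (hdep : ∀ s, f (setCoord k x s) = f (setCoord k y s)) :
    ∫ z, f z ∂gibbsStep κ k x - ∫ z, f z ∂gibbsStep κ k y ≤
      tvDist (κ k (dropCoord k x)) (κ k (dropCoord k y)) := by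
  have hfb : IsBddMeas f := .of_mem_Icc hf hf01
  have hset : Measurable (setCoord k x) := (measurable_setCoord k).comp measurable_prodMk_left
  rw [integral_gibbsStep κ k x hfb, integral_gibbsStep κ k y hfb]
  simp only [← hdep]
  have := mul_one_sub_le_integral_add_integral (κ k (dropCoord k x)) (κ k (dropCoord k y))
    (u := fun s => 1 - f (setCoord k x s)) (v := fun s => f (setCoord k x s)) (b := 1)
    (((isBddMeas_const 1).sub hfb).comp hset) (hfb.comp hset)
    (fun s => sub_nonneg.2 (hf01 _).2) (fun s => (hf01 _).1) zero_le_one (fun s => by simp) le_rfl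
  rw [integral_sub (integrable_const _) ((hfb.comp hset).integrable _)] at this
  simp only [integral_const, smul_eq_mul, probReal_univ, one_mul] at this
  linarith

end Overlap

/-! ### From the Poincaré inequality to isoperimetry and flow. -/

section Isoperimetry

variable {d : ℕ}

theorem gradNorm_le_of_lipschitzWith {f : Space d → ℝ} {L : ℝ≥0} (hf : LipschitzWith L f)
    (x : Space d) : gradNorm f x ≤ L := by
  unfold gradNorm
  split_ifs with h
  · have h1 : ‖gradient f x‖ ≤ L := by
      rw [gradient, LinearIsometryEquiv.norm_map]
      exact norm_fderiv_le_of_lipschitz ℝ hf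
    rw [enorm_eq_nnnorm]
    exact_mod_cast h1
  · refine limsup_le_of_le (by isBoundedDefault) (Eventually.of_forall fun y => ?_)
    refine ENNReal.div_le_of_le_mul ?_
    simpa [edist_eq_enorm_sub] using hf y x

theorem gradNorm_eq_zero_of_eventuallyEq {f : Space d → ℝ} {x : Space d} {c : ℝ}
    (h : f =ᶠ[𝓝 x] fun _ => c) : gradNorm f x = 0 := by
  have hd : DifferentiableAt ℝ f x := (differentiableAt_const c).congr_of_eventuallyEq h
  rw [gradNorm, if_pos hd, gradient, h.fderiv_eq]
  simp

/-- The function of the distance to `G` that is `0` near `G`, `2` at distances above `17δ/8` and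
has slope `1/δ` in between. -/
noncomputable def cutoff (G : Set (Space d)) (δ : ℝ) (x : Space d) : ℝ :=
  max 0 (min 2 (Metric.infDist x G / δ - 1 / 8))

theorem lipschitzWith_cutoff (G : Set (Space d)) {δ : ℝ} (hδ : 0 < δ) :
    LipschitzWith (Real.toNNReal (1 / δ)) (cutoff G δ) := by
  refine (LipschitzWith.const_min ?_ 2).const_max 0
  refine LipschitzWith.of_dist_le_mul fun x y => ?_
  have h := (Metric.lipschitz_infDist_pt G).dist_le_mul x y
  rw [Real.coe_toNNReal _ (by positivity)]
  simp only [Real.dist_eq, NNReal.coe_one, one_mul] at h ⊢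
  rw [show Metric.infDist x G / δ - 1 / 8 - (Metric.infDist y G / δ - 1 / 8) =
    1 / δ * (Metric.infDist x G - Metric.infDist y G) by ring, abs_mul, abs_of_pos (by positivity)]
  gcongr

theorem cutoff_eq_zero {G : Set (Space d)} {δ : ℝ} (hδ : 0 < δ) {x : Space d}
    (h : Metric.infDist x G ≤ δ / 8) : cutoff G δ x = 0 := by
  refine max_eq_left ((min_le_right _ _).trans ?_)
  have : Metric.infDist x G / δ ≤ 1 / 8 := by
    rw [div_le_iff₀ hδ]
    linarith
  linarith

theorem cutoff_eq_two {G : Set (Space d)} {δ : ℝ} (hδ : 0 < δ) {x : Space d}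
    (h : 17 / 8 * δ ≤ Metric.infDist x G) : cutoff G δ x = 2 := by
  have : 17 / 8 ≤ Metric.infDist x G / δ := by rwa [le_div_iff₀ hδ]
  rw [cutoff, min_eq_left (by linarith)]
  norm_num

/-- The cutoff rises from `0` to `2` with slope `1/δ` over a width `2δ`. The remaining `δ/4` of the
separation leaves a margin `δ/8` at each end, so the cutoff is locally constant around the points of
both sets and its gradient lives on the complement of their union. -/
theorem isoperimetry {π : Measure (Space d)} [IsProbabilityMeasure π] {q C δ : ℝ} (hq : 1 ≤ q)
    (hC : 0 < C) (hδ : 0 < δ) (hPI : PoincareInequality π q C) {G₁ G₂ : Set (Space d)}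
    (h₁ : MeasurableSet G₁) (h₂ : MeasurableSet G₂)
    (hsep : ∀ x ∈ G₁, ∀ y ∈ G₂, 9 / 4 * δ ≤ dist x y) :
    min (π.real G₁) (π.real G₂) * (C * δ ^ q) ≤ π.real (G₁ ∪ G₂)ᶜ := by
  rcases G₁.eq_empty_or_nonempty with rfl | hne
  · rw [measureReal_empty, min_eq_left measureReal_nonneg, zero_mul]
    exact measureReal_nonneg
  have hq0 : 0 < q := by linarith
  set f := cutoff G₁ δ
  have hlip := lipschitzWith_cutoff G₁ hδ
  have hf1 : ∀ x ∈ G₁, f =ᶠ[𝓝 x] fun _ => 0 := by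
    intro x hx
    filter_upwards [Metric.ball_mem_nhds x (show 0 < δ / 8 by positivity)] with y hy
    exact cutoff_eq_zero hδ ((Metric.infDist_le_dist_of_mem hx).trans (Metric.mem_ball.1 hy).le)
  have hf2 : ∀ x ∈ G₂, f =ᶠ[𝓝 x] fun _ => 2 := by
    intro x hx
    filter_upwards [Metric.ball_mem_nhds x (show 0 < δ / 8 by positivity)] with y hy
    have h1 : 9 / 4 * δ ≤ Metric.infDist x G₁ :=
      (Metric.le_infDist hne).2 fun z hz => by rw [dist_comm]; exact hsep z hz x hx
    have h2 : Metric.infDist x G₁ ≤ Metric.infDist y G₁ + dist x y :=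
      Metric.infDist_le_infDist_add_dist
    rw [Metric.mem_ball, dist_comm] at hy
    exact cutoff_eq_two hδ (by linarith)
  have hint : Integrable f π := by
    refine IsBddMeas.integrable ⟨hlip.continuous.measurable, 2, fun x => ?_⟩ π
    rw [abs_of_nonneg (le_max_left _ _)]
    exact max_le zero_le_two (min_le_left _ _)
  have key := hPI f hlip.locallyLipschitz hint
  set m := ∫ y, f y ∂π
  have hlow : ∀ (G : Set (Space d)) (c : ℝ), MeasurableSet G → (∀ x ∈ G, f x = c) →
      1 ≤ |c - m| → π G ≤ ∫⁻ x, ‖f x - m‖ₑ ^ q ∂π := by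
    intro G c hG hc hcm
    rw [← lintegral_indicator_one hG]
    refine lintegral_mono fun x => ?_
    by_cases hx : x ∈ G
    · simp only [hx, Set.indicator_of_mem, Pi.one_apply, hc x hx]
      refine ENNReal.one_le_rpow ?_ hq0
      rw [enorm_eq_nnnorm]
      exact_mod_cast (show (1 : ℝ) ≤ ‖c - m‖ from hcm)
    · simp [hx]
  -- Whatever the mean `m`, it is at distance at least `1` from `0` or from `2`, so the `q`-th power
  -- costs no constant depending on `q`.
  have hmin : min (π G₁) (π G₂) ≤ ∫⁻ x, ‖f x - m‖ₑ ^ q ∂π := by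
    rcases le_total 1 m with hm | hm
    · exact (min_le_left _ _).trans (hlow G₁ 0 h₁ (fun x hx => (hf1 x hx).eq_of_nhds)
        (by rw [zero_sub, abs_neg]; exact hm.trans (le_abs_self m)))
    · exact (min_le_right _ _).trans (hlow G₂ 2 h₂ (fun x hx => (hf2 x hx).eq_of_nhds)
        ((by linarith : (1 : ℝ) ≤ 2 - m).trans (le_abs_self _)))
  have hgrad : ∫⁻ x, gradNorm f x ^ q ∂π ≤ ENNReal.ofReal ((1 / δ) ^ q) * π (G₁ ∪ G₂)ᶜ := by
    rw [← lintegral_indicator_const (h₁.union h₂).compl]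
    refine lintegral_mono fun x => ?_
    by_cases hx : x ∈ G₁ ∪ G₂
    · have : gradNorm f x = 0 :=
        hx.elim (fun h => gradNorm_eq_zero_of_eventuallyEq (hf1 x h))
          fun h => gradNorm_eq_zero_of_eventuallyEq (hf2 x h)
      simp [this, hq0]
    · rw [Set.indicator_of_mem (by exact hx), ← ENNReal.ofReal_rpow_of_pos (by positivity)]
      exact ENNReal.rpow_le_rpow (gradNorm_le_of_lipschitzWith hlip x) hq0.le
  have hfin : min (π G₁) (π G₂) ≤
      ENNReal.ofReal (C⁻¹ * ((1 / δ) ^ q * π.real (G₁ ∪ G₂)ᶜ)) := by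
    refine (hmin.trans key).trans ?_
    rw [ENNReal.ofReal_mul (by positivity), ENNReal.ofReal_mul (by positivity),
      ENNReal.ofReal_inv_of_pos hC, ofReal_measureReal]
    gcongr
  have hreal : min (π.real G₁) (π.real G₂) ≤ C⁻¹ * ((1 / δ) ^ q * π.real (G₁ ∪ G₂)ᶜ) := by
    have := ENNReal.toReal_mono ENNReal.ofReal_ne_top hfin
    rwa [ENNReal.toReal_ofReal (by positivity),
      ENNReal.toReal_min (measure_ne_top _ _) (measure_ne_top _ _)] at this
  calc min (π.real G₁) (π.real G₂) * (C * δ ^ q)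
      ≤ C⁻¹ * ((1 / δ) ^ q * π.real (G₁ ∪ G₂)ᶜ) * (C * δ ^ q) := by gcongr
    _ = π.real (G₁ ∪ G₂)ᶜ := by
      rw [Real.div_rpow zero_le_one hδ.le, Real.one_rpow]
      have : δ ^ q ≠ 0 := (Real.rpow_pos_of_pos hδ q).ne'
      field_simp

/-- If `u` and `v` have mean `p ≤ 1/2` and level sets near `1` and `0` that are far apart, then
the flow `E[u (1 - v)]` is large. -/
theorem flow_lower_bound {π : Measure (Space d)} [IsProbabilityMeasure π] {q C δ p ε : ℝ}
    (hq : 1 ≤ q) (hC : 0 < C) (hδ : 0 < δ) (hε : 0 < ε) (hε' : ε ≤ 1 / 2)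
    (hPI : PoincareInequality π q C)
    {u v : Space d → ℝ} (hu : Measurable u) (hv : Measurable v)
    (hu01 : ∀ x, u x ∈ Set.Icc (0 : ℝ) 1) (hv01 : ∀ x, v x ∈ Set.Icc (0 : ℝ) 1)
    (hup : ∫ x, u x ∂π = p) (hvp : ∫ x, v x ∂π = p) (hp : p ≤ 1 / 2)
    (hsep : ∀ x y, 1 - ε < u x → 1 - ε < v x → u y < ε → v y < ε → 9 / 4 * δ ≤ dist x y) :
    p * min 1 (C * δ ^ q) ≤ 4 / ε * ∫ x, u x * (1 - v x) ∂π := by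
  have hub : IsBddMeas u := .of_mem_Icc hu hu01
  have hvb : IsBddMeas v := .of_mem_Icc hv hv01
  have h1 := isBddMeas_const (α := Space d) 1
  set F := ∫ x, u x * (1 - v x) ∂π with hF
  -- Equality of the two means makes both terms integrate to `F`. The symmetric `w` is at least `ε`
  -- off `G₁ ∪ G₂`.
  set w : Space d → ℝ := fun x => u x * (1 - v x) + v x * (1 - u x) with hwdef
  have hwb : IsBddMeas w := (hub.mul (h1.sub hvb)).add (hvb.mul (h1.sub hub))
  have hF0 : 0 ≤ F :=
    integral_nonneg fun x => mul_nonneg (hu01 x).1 (sub_nonneg.2 (hv01 x).2)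
  have hwF : ∫ x, w x ∂π = 2 * F := by
    have e1 : ∫ x, u x * (1 - v x) ∂π = p - ∫ x, u x * v x ∂π := by
      rw [← hup, ← integral_sub (hub.integrable _) ((hub.mul hvb).integrable _)]
      congr with x
      ring
    have e2 : ∫ x, v x * (1 - u x) ∂π = p - ∫ x, u x * v x ∂π := by
      rw [← hvp, ← integral_sub (hvb.integrable _) ((hub.mul hvb).integrable _)]
      congr with x
      ring
    rw [hwdef, integral_add ((hub.mul (h1.sub hvb)).integrable _)
      ((hvb.mul (h1.sub hub)).integrable _), e2, ← e1]
    ring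
  set G₁ : Set (Space d) := {x | 1 - ε < u x ∧ 1 - ε < v x} with hG₁
  set G₂ : Set (Space d) := {x | u x < ε ∧ v x < ε} with hG₂
  have hm₁ : MeasurableSet G₁ :=
    (measurableSet_lt measurable_const hu).inter (measurableSet_lt measurable_const hv)
  have hm₂ : MeasurableSet G₂ :=
    (measurableSet_lt hu measurable_const).inter (measurableSet_lt hv measurable_const)
  have hiso := isoperimetry hq hC hδ hPI hm₁ hm₂
    fun x hx y hy => hsep x y hx.1 hx.2 hy.1 hy.2
  have hbound : ∀ (G : Set (Space d)) (g : Space d → ℝ), MeasurableSet G → IsBddMeas g →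
      (∀ x, g x ≤ 1) → (∀ x, x ∉ G → g x * ε ≤ w x) → ∫ x, g x ∂π ≤ π.real G + 2 / ε * F := by
    intro G g hG hg hg1 hgw
    have hwε := (isBddMeas_const (α := Space d) (1 / ε)).mul hwb
    have hind := isBddMeas_indicator hG
    calc ∫ x, g x ∂π ≤ ∫ x, (G.indicator (fun _ => (1 : ℝ)) x + 1 / ε * w x) ∂π := by
          refine integral_mono (hg.integrable _) ((hind.add hwε).integrable _) fun x => ?_
          have hw0 : 0 ≤ w x := add_nonneg (mul_nonneg (hu01 x).1 (sub_nonneg.2 (hv01 x).2))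
            (mul_nonneg (hv01 x).1 (sub_nonneg.2 (hu01 x).2))
          by_cases hx : x ∈ G
          · have : 0 ≤ 1 / ε * w x := by positivity
            simpa [hx] using (hg1 x).trans (by simpa using this)
          · have := hgw x hx
            rw [← le_div_iff₀ hε] at this
            simpa [hx, div_eq_inv_mul] using this
      _ = π.real G + 2 / ε * F := by
          rw [integral_add (hind.integrable _) (hwε.integrable _), integral_const_mul, hwF,
            integral_indicator_const _ hG]
          simp only [smul_eq_mul]
          ring
  have hcase : ∀ x, x ∉ G₁ → x ∉ G₂ → ε ≤ w x := by
    intro x hx1 hx2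
    obtain ⟨hu0, hu1⟩ := hu01 x
    obtain ⟨hv0, hv1⟩ := hv01 x
    by_contra hlt
    push Not at hlt
    have hw : w x = u x * (1 - v x) + v x * (1 - u x) := rfl
    rw [hw] at hlt
    rcases le_or_gt (u x) (1 - ε) with ha | ha <;> rcases le_or_gt ε (u x) with hb | hb
    · nlinarith
    · rcases le_or_gt ε (v x) with hc | hc
      · nlinarith
      · exact hx2 ⟨hb, hc⟩
    · rcases le_or_gt (v x) (1 - ε) with hc | hc
      · nlinarith
      · exact hx1 ⟨ha, hc⟩
    · linarith
  have b1 : p ≤ π.real G₁ + 2 / ε * F := by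
    rw [← hup]
    refine hbound G₁ u hm₁ hub (fun x => (hu01 x).2) fun x hx => ?_
    obtain ⟨hu0, hu1⟩ := hu01 x
    obtain ⟨hv0, hv1⟩ := hv01 x
    by_cases hx2 : x ∈ G₂
    · have hw : w x = u x * (1 - v x) + v x * (1 - u x) := rfl
      have := hx2.2
      rw [hw]
      nlinarith [mul_nonneg hv0 (sub_nonneg.2 hu1)]
    · nlinarith [hcase x hx hx2]
  have b2 : 1 - p ≤ π.real G₂ + 2 / ε * F := by
    have := hbound G₂ (fun x => 1 - u x) hm₂ (h1.sub hub)
      (fun x => by linarith [(hu01 x).1]) fun x hx => ?_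
    · rwa [integral_sub (integrable_const _) (hub.integrable _), hup, integral_const, smul_eq_mul,
        probReal_univ, one_mul] at this
    obtain ⟨hu0, hu1⟩ := hu01 x
    obtain ⟨hv0, hv1⟩ := hv01 x
    by_cases hx1 : x ∈ G₁
    · have hw : w x = u x * (1 - v x) + v x * (1 - u x) := rfl
      have := hx1.2
      rw [hw]
      nlinarith [mul_nonneg hu0 (sub_nonneg.2 hv1)]
    · nlinarith [hcase x hx1 hx]
  have b3 : π.real (G₁ ∪ G₂)ᶜ ≤ 2 / ε * F := by
    have hm := hm₁.union hm₂
    have := hbound (G₁ ∪ G₂) (fun _ => 1) hm h1 (fun x => le_rfl) fun x hx => ?_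
    · rw [probReal_compl_eq_one_sub hm]
      simp only [integral_const, smul_eq_mul, probReal_univ, one_mul] at this
      linarith
    · rw [one_mul]
      exact hcase x (fun h => hx (Or.inl h)) fun h => hx (Or.inr h)
  have hp0 : 0 ≤ p := hup ▸ integral_nonneg fun x => (hu01 x).1
  have hCδ : 0 < C * δ ^ q := by positivity
  -- Either the flow already dominates `p`, or both level sets keep mass at least `p / 2` (for `G₂`
  -- by `p ≤ 1/2`) and isoperimetry applies.
  rcases le_or_gt p (4 / ε * F) with hsmall | hlarge
  · exact (mul_le_of_le_one_right hp0 (min_le_left _ _)).trans hsmall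
  · have e : 4 / ε * F = 2 * (2 / ε * F) := by ring
    have hmin : p / 2 ≤ min (π.real G₁) (π.real G₂) := le_min (by linarith) (by linarith)
    have : p / 2 * (C * δ ^ q) ≤ 2 / ε * F :=
      ((mul_le_mul_of_nonneg_right hmin hCδ.le).trans hiso).trans b3
    calc p * min 1 (C * δ ^ q) ≤ p * (C * δ ^ q) := by gcongr; exact min_le_right _ _
      _ ≤ 4 / ε * F := by linarith

end Isoperimetry

/-! ### Overlap of the systematic scan at the scale `δ`. -/

section Flow

variable {d : ℕ} (κ : (k : Fin d) → Kernel (SpaceDrop k) ℝ) [∀ k, IsMarkovKernel (κ k)]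

theorem gibbsStep_congr (k : Fin d) {x y : Space d} (h : dropCoord k x = dropCoord k y) :
    gibbsStep κ k x = gibbsStep κ k y := by
  rw [gibbsStep_apply, gibbsStep_apply, h, funext (setCoord_eq_iff k x y · h)]

theorem integral_gibbsStep_idem (k : Fin d) (f : Space d → ℝ) (x : Space d) :
    ∫ y, (∫ z, f z ∂gibbsStep κ k y) ∂gibbsStep κ k x = ∫ z, f z ∂gibbsStep κ k x := by
  have hm : Measurable (setCoord k x) := (measurable_setCoord k).comp measurable_prodMk_left
  have := isMarkovKernel_gibbsStep κ k
  have hae : ∀ᵐ y ∂gibbsStep κ k x, dropCoord k y = dropCoord k x := by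
    rw [gibbsStep_apply, ae_map_iff (p := fun y => dropCoord k y = dropCoord k x)
      hm.aemeasurable (measurable_dropCoord k (measurableSet_singleton _))]
    exact Eventually.of_forall fun t => dropCoord_setCoord k x t
  rw [integral_congr_ae (g := fun _ => ∫ z, f z ∂gibbsStep κ k x)
    (hae.mono fun y hy => by simp only [gibbsStep_congr κ k hy])]
  simp

/-- The scale `(M d)^(-1/β)` below which the systematic scan mixes. -/
noncomputable def mixingScale (M β : ℝ) (d : ℕ) : ℝ := (M * d) ^ (-1 / β)

theorem mixingScale_pos {M β : ℝ} (hM : 0 < M) (hd : 1 ≤ d) : 0 < mixingScale M β d := by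
  have : (0 : ℝ) < d := by exact_mod_cast hd
  unfold mixingScale
  positivity

theorem mixingScale_rpow {M β : ℝ} (hM : 0 < M) (hd : 1 ≤ d) (s : ℝ) :
    mixingScale M β d ^ s = ((M * d) ^ (s / β))⁻¹ := by
  have : (0 : ℝ) < d := by exact_mod_cast hd
  rw [mixingScale, ← Real.rpow_mul (by positivity), ← Real.rpow_neg (by positivity)]
  congr 1
  ring

/-- The inequality `log s ≥ 1 - 1/s` gives the exponent `-(9/4) d / (d - 9/4)`, which is smallest at
`d = 3`, with value `-9`. -/
theorem exp_neg_nine_le_pow (hd : 3 ≤ d) : Real.exp (-9) ≤ (1 - 9 / 4 / (d : ℝ)) ^ d := by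
  have hd' : (3 : ℝ) ≤ d := by exact_mod_cast hd
  have hpos : 0 < 1 - 9 / 4 / (d : ℝ) := by
    rw [sub_pos, div_lt_one (by linarith)]
    linarith
  have h := Real.one_sub_inv_le_log_of_pos hpos
  rw [← Real.rpow_natCast, Real.rpow_def_of_pos hpos, Real.exp_le_exp]
  have h2 : -9 ≤ (1 - (1 - 9 / 4 / (d : ℝ))⁻¹) * d := by
    have h3 : (1 - (1 - 9 / 4 / (d : ℝ))⁻¹) * d = -(9 / 4 * d) / (d - 9 / 4) := by
      have : (d : ℝ) - 9 / 4 ≠ 0 := by linarith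
      have h5 : (1 - 9 / 4 / (d : ℝ)) = (d - 9 / 4) / d := by field_simp
      rw [h5, inv_div, one_sub_div this, div_mul_eq_mul_div]
      ring
    rw [h3, le_div_iff₀ (by linarith)]
    linarith
  have := mul_le_mul_of_nonneg_right h (by linarith : (0 : ℝ) ≤ d)
  linarith

/-- Since `M δ^β = 1/d`, a displacement of `9δ/4` changes each conditional law by at most `(9/4)^β /
d ≤ 9/(4d)`, which is below `1` only for `d ≥ 3`. For `d = 1` there is nothing to condition on, and
the overlap is complete. -/
theorem exp_neg_nine_le_systematicScan_overlap {M β : ℝ} (hd : 1 ≤ d) (hd2 : d ≠ 2) (hM : 0 < M)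
    (hβ : 0 < β) (hβ' : β ≤ 1) (hTV : TVContinuous κ M β) {f : Space d → ℝ} (hf : Measurable f)
    (hf01 : ∀ x, f x ∈ Set.Icc (0 : ℝ) 1) (x y : Space d)
    (hxy : ‖x - y‖ ≤ 9 / 4 * mixingScale M β d) :
    Real.exp (-9) ≤ ∫ z, (1 - f z) ∂systematicScan κ x + ∫ z, f z ∂systematicScan κ y := by
  have hmem : ∀ j, j ∉ List.finRange d → x j = y j := fun j hj => absurd (List.mem_finRange j) hj
  rw [systematicScan_eq_scan]
  obtain rfl | hd3 : d = 1 ∨ 3 ≤ d := by omega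
  · have h := pow_le_scan_overlap κ (r := ‖x - y‖) (t := 0) zero_le_one (fun k x y _ => ?_)
      hf hf01 (List.finRange 1) x y le_rfl hmem
    · refine le_trans ?_ h
      simp
    · have : IsEmpty {j : Fin 1 // j ≠ k} := ⟨fun j => j.2 (Subsingleton.elim _ _)⟩
      rw [Subsingleton.elim (dropCoord k x) (dropCoord k y)]
      simp [tvDist]
  · have hd' : (3 : ℝ) ≤ d := by exact_mod_cast hd3
    have hδ := mixingScale_pos (β := β) hM hd
    have h := pow_le_scan_overlap κ (r := 9 / 4 * mixingScale M β d) (t := 9 / 4 / (d : ℝ))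
      ?_ (fun k x y hxy => ?_) hf hf01 (List.finRange d) x y hxy hmem
    · rw [List.length_finRange] at h
      exact (exp_neg_nine_le_pow hd3).trans h
    · rw [div_le_one (by linarith)]
      linarith
    · refine (hTV k x y).trans ?_
      calc M * ‖dropCoord k x - dropCoord k y‖ ^ β
          ≤ M * (9 / 4 * mixingScale M β d) ^ β := by
            gcongr
            exact (norm_dropCoord_sub_le k x y).trans hxy
        _ = (9 / 4) ^ β * (1 / d) := by
            rw [Real.mul_rpow (by norm_num) hδ.le, mixingScale_rpow hM hd, div_self hβ.ne',
              Real.rpow_one]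
            field_simp
        _ ≤ (9 / 4) ^ (1 : ℝ) * (1 / d) := by
            gcongr
            norm_num
        _ = 9 / 4 / (d : ℝ) := by rw [Real.rpow_one]; ring

end Flow

/-! ### The case `d = 2`. -/

section TwoCoordinates

variable (κ : (k : Fin 2) → Kernel (SpaceDrop k) ℝ)

theorem norm_dropCoord_fin_two (i k : Fin 2) (hik : i ≠ k) (x y : Space 2) :
    ‖dropCoord k x - dropCoord k y‖ = |x i - y i| := by
  rw [EuclideanSpace.norm_eq]
  simp only [dropCoord, PiLp.sub_apply, Real.norm_eq_abs, sq_abs]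
  rw [← Finset.sum_subtype (Finset.univ.filter (· ≠ k)) (by simp) (fun j => (x j - y j) ^ 2),
    show Finset.univ.filter (· ≠ k) = {i} by ext j; simp; omega, Finset.sum_singleton,
    Real.sqrt_sq_eq_abs]

/-- Here `δ^β = 1/(2M)`, so a variation of `4/5` forces `(|x i - y i| / δ)^β ≥ 8/5`, and `β ≤ 1`
allows the exponent to be dropped. -/
theorem le_abs_sub_of_le_tvDist {M β : ℝ} (hM : 0 < M) (hβ : 0 < β) (hβ' : β ≤ 1)
    (hTV : TVContinuous κ M β) {i k : Fin 2} (hik : i ≠ k) {x y : Space 2}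
    (h : 4 / 5 ≤ tvDist (κ k (dropCoord k x)) (κ k (dropCoord k y))) :
    8 / 5 * mixingScale M β 2 ≤ |x i - y i| := by
  have hδ := mixingScale_pos (d := 2) (β := β) hM (by norm_num)
  have h1 := h.trans (hTV k x y)
  rw [norm_dropCoord_fin_two i k hik] at h1
  by_contra hlt
  push Not at hlt
  have h2 : |x i - y i| ^ β < (8 / 5 * mixingScale M β 2) ^ β :=
    Real.rpow_lt_rpow (abs_nonneg _) hlt hβ
  have h3 : (8 / 5 * mixingScale M β 2) ^ β = (8 / 5) ^ β * (1 / (2 * M)) := by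
    rw [Real.mul_rpow (by norm_num) hδ.le, mixingScale_rpow hM (by norm_num), div_self hβ.ne',
      Real.rpow_one]
    push_cast
    field_simp
  have h4 : (8 / 5 : ℝ) ^ β ≤ 8 / 5 := by
    simpa using Real.rpow_le_rpow_of_exponent_le (by norm_num : (1 : ℝ) ≤ 8 / 5) hβ'
  have h5 : M * |x i - y i| ^ β < M * ((8 / 5) ^ β * (1 / (2 * M))) := by
    rw [← h3]
    gcongr
  have h6 : M * ((8 / 5) ^ β * (1 / (2 * M))) = (8 / 5) ^ β / 2 := by field_simp
  linarith

/-- Write `g = P₀ b`. As `P₀` is a self-adjoint projection, `E[g b] = E[g²]`, so `E|b - g| ≤ E[b + g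
- 2 g b] = 2 E[g (1 - g)]`. As `b = P₁ b` and `P₁` contracts `L¹`, `P₁ g` is equally close to `b`.
Replacing `P₁ g` by `b` thus costs twice the flow, and `E[g (1 - b)]` is the flow itself. -/
theorem integral_mul_one_sub_gibbsStep_le [∀ k, IsMarkovKernel (κ k)]
    {π : Measure (Space 2)} [IsProbabilityMeasure π] (hκ : IsConditionalFamily π κ)
    {b : Space 2 → ℝ} (hbm : Measurable b)
    (hb01 : ∀ x, b x ∈ Set.Icc (0 : ℝ) 1) (hb : ∀ x, ∫ y, b y ∂gibbsStep κ 1 x = b x) :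
    ∫ x, (∫ y, b y ∂gibbsStep κ 0 x) *
        (1 - ∫ y, (∫ z, b z ∂gibbsStep κ 0 y) ∂gibbsStep κ 1 x) ∂π ≤
      3 * ∫ x, (∫ y, b y ∂gibbsStep κ 0 x) * (1 - ∫ y, b y ∂gibbsStep κ 0 x) ∂π := by
  have hmk := isMarkovKernel_gibbsStep κ
  set g : Space 2 → ℝ := fun x => ∫ y, b y ∂gibbsStep κ 0 x with hg
  have hbb : IsBddMeas b := .of_mem_Icc hbm hb01
  have hgb : IsBddMeas g := hbb.integral_kernel _
  have hg01 : ∀ x, g x ∈ Set.Icc (0 : ℝ) 1 := fun x => integral_kernel_mem_Icc hbm hb01 _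
  have h1 := isBddMeas_const (α := Space 2) 1
  set k : Space 2 → ℝ := fun x => ∫ y, g y ∂gibbsStep κ 1 x with hk
  have hkb : IsBddMeas k := hgb.integral_kernel _
  have hsym : ∫ x, g x * g x ∂π = ∫ x, g x * b x ∂π := by
    have := integral_mul_gibbsStep_comm κ hκ 0 hgb hbb
    simp only [hg, integral_gibbsStep_idem] at this
    exact this
  have hgg : ∫ x, g x * (1 - g x) ∂π = ∫ x, g x ∂π - ∫ x, g x * g x ∂π := by
    rw [← integral_sub (hgb.integrable _) ((hgb.mul hgb).integrable _)]
    congr with x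
    ring
  have hdist : ∫ x, |b x - g x| ∂π ≤ 2 * ∫ x, g x * (1 - g x) ∂π := by
    calc ∫ x, |b x - g x| ∂π ≤ ∫ x, (b x + g x - (g x * b x + g x * b x)) ∂π := by
          refine integral_mono ((hbb.sub hgb).abs.integrable _)
            (((hbb.add hgb).sub ((hgb.mul hbb).add (hgb.mul hbb))).integrable _) fun x => ?_
          obtain ⟨hb0, hb1⟩ := hb01 x
          obtain ⟨hg0, hg1⟩ := hg01 x
          refine abs_le.2 ⟨?_, ?_⟩
          · nlinarith [mul_nonneg hb0 (sub_nonneg.2 hg1)]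
          · nlinarith [mul_nonneg hg0 (sub_nonneg.2 hb1)]
      _ = 2 * ∫ x, g x * (1 - g x) ∂π := by
          rw [integral_sub ((hbb.add hgb).integrable _)
            (((hgb.mul hbb).add (hgb.mul hbb)).integrable _),
            integral_add (hbb.integrable _) (hgb.integrable _),
            integral_add ((hgb.mul hbb).integrable _) ((hgb.mul hbb).integrable _), hgg, hsym,
            ← integral_gibbsStep_invariant κ hκ 0 hbb]
          ring
  have hbk : ∫ x, |b x - k x| ∂π ≤ ∫ x, |b x - g x| ∂π := by
    rw [← integral_gibbsStep_invariant κ hκ 1 (hbb.sub hgb).abs]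
    refine integral_mono ((hbb.sub hkb).abs.integrable _)
      (((hbb.sub hgb).abs.integral_kernel _).integrable _) fun x => ?_
    have : b x - k x = ∫ y, (b y - g y) ∂gibbsStep κ 1 x := by
      rw [integral_sub (hbb.integrable _) (hgb.integrable _), hb]
    simp only [this]
    exact abs_integral_le_integral_abs
  calc ∫ x, g x * (1 - k x) ∂π ≤ ∫ x, (g x - g x * b x + |b x - k x|) ∂π := by
        refine integral_mono ((hgb.mul (h1.sub hkb)).integrable _)
          (((hgb.sub (hgb.mul hbb)).add (hbb.sub hkb).abs).integrable _) fun x => ?_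
        obtain ⟨hg0, hg1⟩ := hg01 x
        have := mul_le_of_le_one_left (abs_nonneg (b x - k x)) hg1
        have := mul_le_mul_of_nonneg_left (le_abs_self (b x - k x)) hg0
        show g x * (1 - k x) ≤ g x - g x * b x + |b x - k x|
        linarith
    _ = ∫ x, g x * (1 - g x) ∂π + ∫ x, |b x - k x| ∂π := by
        rw [integral_add ((hgb.sub (hgb.mul hbb)).integrable _) ((hbb.sub hkb).abs.integrable _),
          integral_sub (hgb.integrable _) ((hgb.mul hbb).integrable _), hgg, hsym]
    _ ≤ 3 * ∫ x, g x * (1 - g x) ∂π := by linarith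

theorem dropCoord_eq_of_setCoord_fin_two {i k : Fin 2} (hik : i ≠ k) (x y : Space 2) (s : ℝ) :
    dropCoord k (setCoord i x s) = dropCoord k (setCoord i y s) := by
  ext ⟨j, hj⟩
  have : j = i := by omega
  simp [dropCoord, setCoord, this]

end TwoCoordinates

/-! ### The flow bound in every dimension. -/

section FlowBound

theorem exp_neg_nine_le : Real.exp (-9) ≤ 1 / 10 := by
  have h := Real.add_one_le_exp (9 : ℝ)
  rw [Real.exp_neg, ← one_div]
  exact one_div_le_one_div_of_le (by norm_num) (by linarith)

/-- The flow `E[g (1 - g)]`, `g = P f`, of the systematic scan is bounded below. -/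
theorem systematicScan_flow_lower_bound {d : ℕ} (hd : 1 ≤ d) {π : Measure (Space d)}
    [IsProbabilityMeasure π] (κ : (k : Fin d) → Kernel (SpaceDrop k) ℝ)
    [∀ k, IsMarkovKernel (κ k)] (hκ : IsConditionalFamily π κ) {q C M β : ℝ} (hq : 1 ≤ q)
    (hC : 0 < C) (hM : 0 < M) (hβ : 0 < β) (hβ' : β ≤ 1) (hPI : PoincareInequality π q C)
    (hTV : TVContinuous κ M β) {f : Space d → ℝ} (hf : Measurable f)
    (hf01 : ∀ x, f x ∈ Set.Icc (0 : ℝ) 1) (hfπ : ∫ x, f x ∂π ≤ 1 / 2) :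
    (∫ x, f x ∂π) * min 1 (C * mixingScale M β d ^ q) ≤
      3 * (4 / (Real.exp (-9) / 2)) * ∫ x, (∫ y, f y ∂systematicScan κ x) *
        (1 - ∫ y, f y ∂systematicScan κ x) ∂π := by
  have hδ := mixingScale_pos (β := β) hM hd
  have hexp := Real.exp_pos (-9)
  have hexp' := exp_neg_nine_le
  have hfb : IsBddMeas f := .of_mem_Icc hf hf01
  have hmk : IsMarkovKernel (systematicScan κ) := by
    rw [systematicScan_eq_scan]
    exact isMarkovKernel_scan κ _
  have hgb := hfb.integral_kernel (systematicScan κ)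
  have hg01 : ∀ x, ∫ y, f y ∂systematicScan κ x ∈ Set.Icc (0 : ℝ) 1 :=
    fun x => integral_kernel_mem_Icc hf hf01 _
  have hgπ : ∫ x, (∫ y, f y ∂systematicScan κ x) ∂π = ∫ x, f x ∂π := by
    rw [systematicScan_eq_scan]
    exact integral_scan_invariant κ hκ _ hfb
  have hF0 : 0 ≤ ∫ x, (∫ y, f y ∂systematicScan κ x) *
        (1 - ∫ y, f y ∂systematicScan κ x) ∂π :=
    integral_nonneg fun x => mul_nonneg (hg01 x).1 (sub_nonneg.2 (hg01 x).2)
  rw [mul_comm 3, mul_assoc]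
  by_cases hd2 : d = 2
  · subst hd2
    have hmks := isMarkovKernel_gibbsStep κ
    set b : Space 2 → ℝ := fun x => ∫ y, f y ∂gibbsStep κ 1 x with hb
    have hbm : IsBddMeas b := hfb.integral_kernel _
    have hb01 : ∀ x, b x ∈ Set.Icc (0 : ℝ) 1 := fun x => integral_kernel_mem_Icc hf hf01 _
    have hg : ∀ x, ∫ y, f y ∂systematicScan κ x = ∫ y, b y ∂gibbsStep κ 0 x := by
      intro x
      rw [systematicScan_eq_scan, show List.finRange 2 = [0, 1] from rfl, scan_cons,
        scan_cons, scan_nil]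
      rw [integral_kernel_comp _ _ hfb]
      refine integral_congr_ae (Eventually.of_forall fun y => ?_)
      simp only [hb, Kernel.id_comp]
    simp only [hg] at hgb hg01 hgπ hF0 ⊢
    -- `g` depends only on `x 1` and `h = P₁ g` only on `x 0`. Asking both to be near `1`, or both
    -- near `0`, separates the level sets in both coordinates.
    set g : Space 2 → ℝ := fun x => ∫ y, b y ∂gibbsStep κ 0 x with hgdef
    set h : Space 2 → ℝ := fun x => ∫ y, g y ∂gibbsStep κ 1 x with hh
    have hhb : IsBddMeas h := hgb.integral_kernel _
    have hflow := flow_lower_bound (p := ∫ x, f x ∂π) (ε := Real.exp (-9) / 2) hq hC hδ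
      (by positivity) (by linarith) hPI hgb.1 hhb.1 hg01
      (fun x => integral_kernel_mem_Icc hgb.1 hg01 _) hgπ
      ((integral_gibbsStep_invariant κ hκ 1 hgb).trans hgπ) hfπ
      (fun x y hgx hhx hgy hhy => ?_)
    · refine hflow.trans (mul_le_mul_of_nonneg_left ?_ (by positivity))
      exact integral_mul_one_sub_gibbsStep_le κ hκ hbm.1 hb01
        fun x => integral_gibbsStep_idem κ 1 f x
    · have t0 := integral_gibbsStep_sub_le κ 0 x y hbm.1 hb01 fun s => by
        simp only [hb, gibbsStep_congr κ 1
          (dropCoord_eq_of_setCoord_fin_two (i := 0) (k := 1) (by decide) x y s)]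
      have t1 := integral_gibbsStep_sub_le κ 1 x y hgb.1 hg01 fun s => by
        simp only [hgdef, gibbsStep_congr κ 0
          (dropCoord_eq_of_setCoord_fin_two (i := 1) (k := 0) (by decide) x y s)]
      have s1 := le_abs_sub_of_le_tvDist κ hM hβ hβ' hTV (i := 1) (k := 0) (by decide)
        (show 4 / 5 ≤ _ from le_trans (by linarith) t0)
      have s0 := le_abs_sub_of_le_tvDist κ hM hβ hβ' hTV (i := 0) (k := 1) (by decide)
        (show 4 / 5 ≤ _ from le_trans (by linarith) t1)
      rw [EuclideanSpace.dist_eq, Fin.sum_univ_two]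
      simp only [Real.dist_eq, sq_abs]
      -- The gaps suffice narrowly: `2 (8/5)² = 5.12` against `(9/4)² = 5.0625`.
      refine Real.le_sqrt_of_sq_le ?_
      rw [← sq_abs (x 0 - y 0), ← sq_abs (x 1 - y 1)]
      have q0 := pow_le_pow_left₀ (by positivity) s0 2
      have q1 := pow_le_pow_left₀ (by positivity) s1 2
      nlinarith [sq_nonneg (mixingScale M β 2)]
  · have hflow := flow_lower_bound (p := ∫ x, f x ∂π) (ε := Real.exp (-9) / 2) hq hC hδ
      (by positivity) (by linarith) hPI hgb.1 hgb.1 hg01 hg01 hgπ hgπ hfπ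
      (fun x y hgx _ hgy _ => ?_)
    · refine hflow.trans (mul_le_mul_of_nonneg_left ?_ (by positivity))
      linarith
    -- At a shorter distance the overlap gives `1 - g x + g y ≥ e⁻⁹ = 2ε`, whereas the level sets
    -- make it less than `2ε`.
    · by_contra hlt
      push Not at hlt
      rw [dist_eq_norm] at hlt
      have hov := exp_neg_nine_le_systematicScan_overlap κ hd hd2 hM hβ hβ' hTV hf hf01 x y hlt.le
      rw [integral_sub (integrable_const _) (hfb.integrable _)] at hov
      simp only [integral_const, smul_eq_mul, probReal_univ, one_mul] at hov
      linarith

end FlowBound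

/-! ### From flow to conductance. -/

section Conductance

theorem indicator_mem_Icc {α : Type*} (S : Set α) (x : α) :
    S.indicator (fun _ => (1 : ℝ)) x ∈ Set.Icc (0 : ℝ) 1 := by
  by_cases h : x ∈ S <;> simp [h]

variable {α : Type*} [MeasurableSpace α]

theorem integral_indicator_eq_real (μ : Measure α) {S : Set α} (hS : MeasurableSet S) :
    ∫ x, S.indicator (fun _ => (1 : ℝ)) x ∂μ = μ.real S := by
  rw [integral_indicator_const _ hS, smul_eq_mul, mul_one]

/-- A lower bound on the flow `E[g (1 - g)]`, `g = P 1_S`, bounds the conductance. -/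
theorem le_conductance_of_flow (π : Measure α) [IsProbabilityMeasure π] (P : Kernel α α)
    [IsMarkovKernel P] (hinv : P ∘ₘ π = π) {φ : ℝ}
    (hflow : ∀ S, MeasurableSet S → π.real S ≤ 1 / 2 →
      φ * π.real S ≤ ∫ x, (P x).real S * (1 - (P x).real S) ∂π) :
    ENNReal.ofReal (φ / 2) ≤ conductance π P := by
  refine le_iInf fun S => le_iInf fun hS => le_iInf fun hpos => le_iInf fun hhalf => ?_
  have hhalf' : π.real S ≤ 1 / 2 := by
    have := ENNReal.toReal_mono (by norm_num) hhalf
    simpa [measureReal_def] using this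
  have hind := isBddMeas_indicator hS
  set s : α → ℝ := S.indicator (fun _ => (1 : ℝ)) with hs
  have hgeq : ∀ x, ∫ y, s y ∂P x = (P x).real S := fun x => integral_indicator_eq_real _ hS
  have hgb : IsBddMeas (fun x => (P x).real S) := by
    simpa only [hgeq] using hind.integral_kernel P
  have h1 := isBddMeas_const (α := α) 1
  have hgπ : ∫ x, (P x).real S ∂π = π.real S := by
    simp only [← hgeq]
    rw [← integral_measure_comp _ _ hind, hinv, integral_indicator_eq_real _ hS]
  -- Pointwise `g (1 - g) ≤ s (1 - g) + (1 - s) g`, the fluxes out of and into `S`; stationarity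
  -- makes their integrals equal.
  have hF : ∫ x, (P x).real S * (1 - (P x).real S) ∂π ≤
      2 * ∫ x, s x * (1 - (P x).real S) ∂π := by
    calc ∫ x, (P x).real S * (1 - (P x).real S) ∂π
        ≤ ∫ x, (s x * (1 - (P x).real S) + (s x * (1 - (P x).real S) +
            ((P x).real S - s x))) ∂π := by
          refine integral_mono ((hgb.mul (h1.sub hgb)).integrable _)
            (((hind.mul (h1.sub hgb)).add ((hind.mul (h1.sub hgb)).add
              (hgb.sub hind))).integrable _) fun x => ?_
          have g0 : 0 ≤ (P x).real S := measureReal_nonneg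
          have g1 : (P x).real S ≤ 1 := measureReal_le_one
          by_cases hx : x ∈ S
          · simp only [hs, Set.indicator_of_mem hx]
            nlinarith
          · simp only [hs, Set.indicator_of_notMem hx]
            nlinarith
      _ = 2 * ∫ x, s x * (1 - (P x).real S) ∂π := by
          rw [integral_add ((hind.mul (h1.sub hgb)).integrable _)
            (((hind.mul (h1.sub hgb)).add (hgb.sub hind)).integrable _),
            integral_add ((hind.mul (h1.sub hgb)).integrable _) ((hgb.sub hind).integrable _),
            integral_sub (hgb.integrable _) (hind.integrable _), hgπ,
            integral_indicator_eq_real _ hS]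
          ring
  have hflux : ∫⁻ x in S, P x Sᶜ ∂π = ENNReal.ofReal (∫ x, s x * (1 - (P x).real S) ∂π) := by
    rw [ofReal_integral_eq_lintegral_ofReal ((hind.mul (h1.sub hgb)).integrable _)
      (Eventually.of_forall fun x => mul_nonneg (indicator_mem_Icc S x).1
        (sub_nonneg.2 measureReal_le_one)), ← lintegral_indicator hS]
    refine lintegral_congr fun x => ?_
    by_cases hx : x ∈ S
    · simp only [hs, Set.indicator_of_mem hx, one_mul]
      rw [← probReal_compl_eq_one_sub hS, ofReal_measureReal]
    · simp [hs, hx]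
  rw [hflux, ENNReal.le_div_iff_mul_le (Or.inl hpos.ne') (Or.inl (measure_ne_top _ _)),
    ← ofReal_measureReal, ← ENNReal.ofReal_mul' measureReal_nonneg]
  refine ENNReal.ofReal_le_ofReal ?_
  have := hflow S hS hhalf'
  linarith

end Conductance

/-! ### Cheeger's inequality for self-couplings of `π`. -/

section Cheeger

variable {α : Type*} [MeasurableSpace α]

/-- The median is the infimum of the levels exceeded with probability at most `1/2`. Both strict
level sets are increasing unions, so continuity from below carries the bounds to the infimum. -/
theorem exists_median (π : Measure α) [IsProbabilityMeasure π] {f : α → ℝ} (hf : IsBddMeas f) :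
    ∃ m, π.real {x | m < f x} ≤ 1 / 2 ∧ π.real {x | f x < m} ≤ 1 / 2 := by
  obtain ⟨hm, B, hB⟩ := hf
  set A : Set ℝ := {t | π.real {x | t < f x} ≤ 1 / 2} with hA
  have hne : A.Nonempty := by
    refine ⟨B, ?_⟩
    have : {x | B < f x} = ∅ :=
      Set.eq_empty_of_forall_notMem fun x hx => absurd (abs_le.1 (hB x)).2 (not_le.2 hx)
    simp [hA, this]
  have hbdd : BddBelow A := by
    refine ⟨-B, fun t ht => ?_⟩
    by_contra hlt
    push Not at hlt
    have : {x | t < f x} = Set.univ :=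
      Set.eq_univ_of_forall fun x => hlt.trans_le (abs_le.1 (hB x)).1
    simp only [hA, Set.mem_ofPred_eq, this, probReal_univ] at ht
    norm_num at ht
  have hlim : ∀ S : ℕ → Set α, Monotone S → (∀ n, π.real (S n) ≤ 1 / 2) →
      π.real (⋃ n, S n) ≤ 1 / 2 := by
    intro S hS h
    have ht := (ENNReal.tendsto_toReal (measure_ne_top π (⋃ n, S n))).comp
      (tendsto_measure_iUnion_atTop (μ := π) hS)
    exact le_of_tendsto' ht h
  refine ⟨sInf A, ?_, ?_⟩
  · have e : {x | sInf A < f x} = ⋃ n : ℕ, {x | sInf A + 1 / (n + 1) < f x} := by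
      ext x
      simp only [Set.mem_ofPred_eq, Set.mem_iUnion]
      refine ⟨fun h => ?_, fun ⟨n, h⟩ => lt_trans (lt_add_of_pos_right _ (by positivity)) h⟩
      obtain ⟨n, hn⟩ := exists_nat_one_div_lt (sub_pos.2 h)
      exact ⟨n, by linarith⟩
    rw [e]
    refine hlim _ (fun i j hij x hx => ?_) fun n => ?_
    · refine lt_of_le_of_lt ?_ (show sInf A + 1 / ((i : ℝ) + 1) < f x from hx)
      gcongr
    · obtain ⟨t, ht, hlt⟩ := exists_lt_of_csInf_lt hne
        (show sInf A < sInf A + 1 / ((n : ℝ) + 1) from lt_add_of_pos_right _ (by positivity))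
      exact (measureReal_mono fun x hx => hlt.trans hx).trans ht
  · have e : {x | f x < sInf A} = ⋃ n : ℕ, {x | f x ≤ sInf A - 1 / (n + 1)} := by
      ext x
      simp only [Set.mem_ofPred_eq, Set.mem_iUnion]
      refine ⟨fun h => ?_, fun ⟨n, h⟩ => lt_of_le_of_lt h (sub_lt_self _ (by positivity))⟩
      obtain ⟨n, hn⟩ := exists_nat_one_div_lt (sub_pos.2 h)
      exact ⟨n, by linarith⟩
    rw [e]
    refine hlim _ (fun i j hij x hx => ?_) fun n => ?_
    · refine le_trans (show f x ≤ sInf A - 1 / ((i : ℝ) + 1) from hx) ?_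
      gcongr
    · have hnot : sInf A - 1 / ((n : ℝ) + 1) ∉ A := fun h =>
        absurd (csInf_le hbdd h) (not_le.2 (sub_lt_self _ (by positivity)))
      have hlt : 1 / 2 < π.real {x | sInf A - 1 / ((n : ℝ) + 1) < f x} := not_le.1 hnot
      have hc : {x | f x ≤ sInf A - 1 / ((n : ℝ) + 1)} =
          {x | sInf A - 1 / ((n : ℝ) + 1) < f x}ᶜ := by
        ext x
        simp
      rw [hc, probReal_compl_eq_one_sub (measurableSet_lt measurable_const hm)]
      linarith

variable {π : Measure α} [IsProbabilityMeasure π] {Γ : Measure (α × α)} [IsProbabilityMeasure Γ]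
  {φ : ℝ}

/-- The layer-cake formula: the right side is the `Γ × Lebesgue` measure of the triples with `g p.2
≤ t < g p.1`. Its slice at `t > 0` is `S × Sᶜ` with `S = {t < g}`, of mass at most `1/2`. -/
theorem coarea_inequality (hφ : 0 ≤ φ)
    (hΓ : ∀ S, MeasurableSet S → π.real S ≤ 1 / 2 → φ * π.real S ≤ Γ.real (S ×ˢ Sᶜ))
    {g : α → ℝ} (hg : IsBddMeas g) (hg0 : ∀ x, 0 ≤ g x) (hsupp : π.real {x | 0 < g x} ≤ 1 / 2) :
    φ * ∫ x, g x ∂π ≤ ∫ p, max (g p.1 - g p.2) 0 ∂Γ := by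
  have hm1 : Measurable (fun p : (α × α) × ℝ => g p.1.1) :=
    hg.1.comp (measurable_fst.comp measurable_fst)
  have hm2 : Measurable (fun p : (α × α) × ℝ => g p.1.2) :=
    hg.1.comp (measurable_snd.comp measurable_fst)
  set A : Set ((α × α) × ℝ) := {p | g p.1.2 ≤ p.2 ∧ p.2 < g p.1.1} with hA
  have hAm : MeasurableSet A :=
    (measurableSet_le hm2 measurable_snd).inter (measurableSet_lt measurable_snd hm1)
  have hdiff : IsBddMeas (fun p : α × α => max (g p.1 - g p.2) 0) :=
    ((hg.comp measurable_fst).sub (hg.comp measurable_snd)).max_zero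
  have e1 : ∫⁻ p, ENNReal.ofReal (max (g p.1 - g p.2) 0) ∂Γ = (Γ.prod volume) A := by
    rw [Measure.prod_apply hAm]
    refine lintegral_congr fun p => ?_
    have : Prod.mk p ⁻¹' A = Set.Ico (g p.2) (g p.1) := rfl
    rw [this, Real.volume_Ico, ENNReal.ofReal_max, ENNReal.ofReal_zero, max_eq_left zero_le]
  have e2 : ∫⁻ t in Set.Ioi (0 : ℝ), ENNReal.ofReal φ * π {x | t < g x} ≤ (Γ.prod volume) A := by
    rw [Measure.prod_apply_symm hAm]
    refine le_trans (setLIntegral_mono' measurableSet_Ioi fun t ht => ?_)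
      (setLIntegral_le_lintegral _ _)
    have hS : MeasurableSet {x | t < g x} := measurableSet_lt measurable_const hg.1
    have hset : (fun p : α × α => (p, t)) ⁻¹' A = {x | t < g x} ×ˢ {x | t < g x}ᶜ := by
      ext p
      simp [hA, and_comm]
    rw [hset, ← ofReal_measureReal, ← ofReal_measureReal, ← ENNReal.ofReal_mul hφ]
    refine ENNReal.ofReal_le_ofReal (hΓ _ hS ((measureReal_mono fun x hx => ?_).trans hsupp))
    exact (Set.mem_Ioi.1 ht).trans hx
  have e3 : ENNReal.ofReal φ * ∫⁻ x, ENNReal.ofReal (g x) ∂π ≤ (Γ.prod volume) A := by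
    rw [lintegral_eq_lintegral_meas_lt π (Eventually.of_forall hg0) hg.1.aemeasurable,
      ← lintegral_const_mul' _ _ ENNReal.ofReal_ne_top]
    exact e2
  rw [← e1, ← ofReal_integral_eq_lintegral_ofReal (hg.integrable _) (Eventually.of_forall hg0),
    ← ofReal_integral_eq_lintegral_ofReal (hdiff.integrable _)
      (Eventually.of_forall fun p => le_max_right _ _), ← ENNReal.ofReal_mul hφ] at e3
  exact (ENNReal.ofReal_le_ofReal_iff (integral_nonneg fun p => le_max_right _ _)).1 e3

/-- The coarea inequality for `g²`, with `g₁² - g₂² = (g₁ - g₂)(g₁ + g₂)` split by Young's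
inequality. The weight `φ/4` on `g₁² + g₂²` lets the marginals absorb half of the left side. -/
theorem cheeger_of_support (hφ : 0 < φ) (h1 : ∀ f, IsBddMeas f → ∫ p, f p.1 ∂Γ = ∫ x, f x ∂π)
    (h2 : ∀ f, IsBddMeas f → ∫ p, f p.2 ∂Γ = ∫ x, f x ∂π)
    (hΓ : ∀ S, MeasurableSet S → π.real S ≤ 1 / 2 → φ * π.real S ≤ Γ.real (S ×ˢ Sᶜ))
    {g : α → ℝ} (hg : IsBddMeas g) (hg0 : ∀ x, 0 ≤ g x) (hsupp : π.real {x | 0 < g x} ≤ 1 / 2) :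
    φ ^ 2 / 4 * ∫ x, g x ^ 2 ∂π ≤ ∫ p, (g p.1 - g p.2) ^ 2 ∂Γ := by
  have hg2 := hg.pow 2
  have hco := coarea_inequality hφ.le hΓ hg2 (fun x => sq_nonneg _) (by
    convert hsupp using 4
    exact ⟨fun h => lt_of_le_of_ne (hg0 _) fun h0 => by simp [← h0] at h, fun h => by positivity⟩)
  have hb1 : IsBddMeas (fun p : α × α => g p.1 ^ 2) := hg2.comp measurable_fst
  have hb2 : IsBddMeas (fun p : α × α => g p.2 ^ 2) := hg2.comp measurable_snd
  have hd : IsBddMeas (fun p : α × α => (g p.1 - g p.2) ^ 2) :=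
    ((hg.comp measurable_fst).sub (hg.comp measurable_snd)).pow 2
  have hcd := (isBddMeas_const (α := α × α) (2 / φ)).mul hd
  have hcs := (isBddMeas_const (α := α × α) (φ / 4)).mul (hb1.add hb2)
  have hub : ∫ p, max (g p.1 ^ 2 - g p.2 ^ 2) 0 ∂Γ ≤
      ∫ p, (2 / φ * (g p.1 - g p.2) ^ 2 + φ / 4 * (g p.1 ^ 2 + g p.2 ^ 2)) ∂Γ := by
    refine integral_mono ((hb1.sub hb2).max_zero.integrable _) ((hcd.add hcs).integrable _)
      fun p => ?_
    refine max_le ?_ (by positivity)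
    have key : 0 ≤ 2 / φ * ((g p.1 - g p.2) - φ / 4 * (g p.1 + g p.2)) ^ 2 := by positivity
    have e : 2 / φ * ((g p.1 - g p.2) - φ / 4 * (g p.1 + g p.2)) ^ 2 =
        2 / φ * (g p.1 - g p.2) ^ 2 - (g p.1 ^ 2 - g p.2 ^ 2) +
          φ / 8 * (g p.1 + g p.2) ^ 2 := by
      field_simp
      ring
    have h4 : φ / 8 * (g p.1 + g p.2) ^ 2 ≤ φ / 4 * (g p.1 ^ 2 + g p.2 ^ 2) := by
      nlinarith [mul_nonneg hφ.le (sq_nonneg (g p.1 - g p.2))]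
    linarith
  rw [integral_add (hcd.integrable _) (hcs.integrable _), integral_const_mul, integral_const_mul,
    integral_add (hb1.integrable _) (hb2.integrable _), h1 _ hg2, h2 _ hg2] at hub
  have hfin : φ / 2 * ∫ x, g x ^ 2 ∂π ≤ 2 / φ * ∫ p, (g p.1 - g p.2) ^ 2 ∂Γ := by linarith
  have := mul_le_mul_of_nonneg_left hfin (by positivity : 0 ≤ φ / 2)
  calc φ ^ 2 / 4 * ∫ x, g x ^ 2 ∂π = φ / 2 * (φ / 2 * ∫ x, g x ^ 2 ∂π) := by ring
    _ ≤ φ / 2 * (2 / φ * ∫ p, (g p.1 - g p.2) ^ 2 ∂Γ) := this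
    _ = ∫ p, (g p.1 - g p.2) ^ 2 ∂Γ := by field_simp

/-- Cheeger's inequality for a coupling `Γ` of `π` with itself. -/
theorem cheeger_inequality (hφ : 0 < φ) (h1 : ∀ f, IsBddMeas f → ∫ p, f p.1 ∂Γ = ∫ x, f x ∂π)
    (h2 : ∀ f, IsBddMeas f → ∫ p, f p.2 ∂Γ = ∫ x, f x ∂π)
    (hΓ : ∀ S, MeasurableSet S → π.real S ≤ 1 / 2 → φ * π.real S ≤ Γ.real (S ×ˢ Sᶜ))
    {f : α → ℝ} (hf : IsBddMeas f) (hmean : ∫ x, f x ∂π = 0) :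
    φ ^ 2 / 4 * ∫ x, f x ^ 2 ∂π ≤ ∫ p, (f p.1 - f p.2) ^ 2 ∂Γ := by
  obtain ⟨m, hm1, hm2⟩ := exists_median π hf
  have hc := isBddMeas_const (α := α) m
  have hpos := (hf.sub hc).max_zero
  have hneg := (hc.sub hf).max_zero
  have c1 := cheeger_of_support hφ h1 h2 hΓ hpos (fun x => le_max_right _ _)
    (by simpa using hm1)
  have c2 := cheeger_of_support hφ h1 h2 hΓ hneg (fun x => le_max_right _ _)
    (by simpa using hm2)
  have hdiff : ∀ g : α → ℝ, IsBddMeas g →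
      IsBddMeas (fun p : α × α => (g p.1 - g p.2) ^ 2) := fun g hg =>
    ((hg.comp measurable_fst).sub (hg.comp measurable_snd)).pow 2
  -- The parts of `f` above and below the median each live on mass at most `1/2`, and splitting into
  -- them does not increase the energy.
  have hsum : ∫ p, (max (f p.1 - m) 0 - max (f p.2 - m) 0) ^ 2 ∂Γ +
      ∫ p, (max (m - f p.1) 0 - max (m - f p.2) 0) ^ 2 ∂Γ ≤ ∫ p, (f p.1 - f p.2) ^ 2 ∂Γ := by
    rw [← integral_add ((hdiff _ hpos).integrable _) ((hdiff _ hneg).integrable _)]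
    refine integral_mono (((hdiff _ hpos).add (hdiff _ hneg)).integrable _)
      ((hdiff _ hf).integrable _) fun p => ?_
    show (max (f p.1 - m) 0 - max (f p.2 - m) 0) ^ 2 +
      (max (m - f p.1) 0 - max (m - f p.2) 0) ^ 2 ≤ (f p.1 - f p.2) ^ 2
    rcases le_total m (f p.1) with ha | ha <;> rcases le_total m (f p.2) with hb | hb
    · simp [ha, hb]
    · simp only [max_eq_left (sub_nonneg.2 ha), max_eq_right (sub_nonpos.2 ha),
        max_eq_right (sub_nonpos.2 hb), max_eq_left (sub_nonneg.2 hb)]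
      nlinarith [mul_nonneg (sub_nonneg.2 ha) (sub_nonneg.2 hb)]
    · simp only [max_eq_left (sub_nonneg.2 ha), max_eq_right (sub_nonpos.2 ha),
        max_eq_right (sub_nonpos.2 hb), max_eq_left (sub_nonneg.2 hb)]
      nlinarith [mul_nonneg (sub_nonneg.2 ha) (sub_nonneg.2 hb)]
    · simp only [max_eq_left (sub_nonneg.2 ha), max_eq_right (sub_nonpos.2 ha),
        max_eq_right (sub_nonpos.2 hb), max_eq_left (sub_nonneg.2 hb)]
      apply le_of_eq
      ring
  have hsq : ∫ x, max (f x - m) 0 ^ 2 ∂π + ∫ x, max (m - f x) 0 ^ 2 ∂π =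
      ∫ x, f x ^ 2 ∂π + m ^ 2 := by
    rw [← integral_add ((hpos.pow 2).integrable _) ((hneg.pow 2).integrable _)]
    calc ∫ x, (max (f x - m) 0 ^ 2 + max (m - f x) 0 ^ 2) ∂π
        = ∫ x, (f x ^ 2 - 2 * m * f x + m ^ 2) ∂π := by
          congr with x
          rcases le_total m (f x) with ha | ha
          · rw [max_eq_left (sub_nonneg.2 ha), max_eq_right (sub_nonpos.2 ha)]
            ring
          · rw [max_eq_left (sub_nonneg.2 ha), max_eq_right (sub_nonpos.2 ha)]
            ring
      _ = ∫ x, f x ^ 2 ∂π + m ^ 2 := by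
          have hc2 := (isBddMeas_const (α := α) (2 * m)).mul hf
          rw [integral_add (((hf.pow 2).sub hc2).integrable _) (integrable_const _),
            integral_sub ((hf.pow 2).integrable _) (hc2.integrable _), integral_const_mul, hmean]
          simp
  have : φ ^ 2 / 4 * ∫ x, f x ^ 2 ∂π ≤ φ ^ 2 / 4 * (∫ x, f x ^ 2 ∂π + m ^ 2) := by
    gcongr
    linarith [sq_nonneg m]
  rw [← hsq, mul_add] at this
  linarith

end Cheeger

/-! ### `L²` contraction and mixing time. -/

section Mixing

variable {α : Type*} [MeasurableSpace α] {π : Measure α} [IsProbabilityMeasure π]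
  {P : Kernel α α} [IsMarkovKernel P] {φ : ℝ}

/-- The `L²(π)` contraction of a Markov kernel, in terms of the flow `E[g (1 - g)]`, `g = P 1_S`.
No reversibility or laziness is needed. -/
theorem integral_kernel_sq_le (hinv : P ∘ₘ π = π) (hφ : 0 < φ)
    (hflow : ∀ S, MeasurableSet S → π.real S ≤ 1 / 2 →
      φ * π.real S ≤ ∫ x, (P x).real S * (1 - (P x).real S) ∂π)
    {f : α → ℝ} (hf : IsBddMeas f) (hmean : ∫ x, f x ∂π = 0) :
    ∫ x, (∫ y, f y ∂P x) ^ 2 ∂π ≤ (1 - φ ^ 2 / 8) * ∫ x, f x ^ 2 ∂π := by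
  -- Two conditionally independent steps from one stationary state: both marginals are `π`, and `Γ
  -- (S × Sᶜ)` is exactly the flow.
  set Γ : Measure (α × α) := (P ×ₖ P) ∘ₘ π with hΓdef
  have hprod : ∀ u v : α → ℝ, IsBddMeas u → IsBddMeas v →
      ∫ p, u p.1 * v p.2 ∂Γ = ∫ x, (∫ y, u y ∂P x) * ∫ y, v y ∂P x ∂π := by
    intro u v hu hv
    rw [hΓdef, integral_measure_comp _ _ ((hu.comp measurable_fst).mul (hv.comp measurable_snd))]
    refine integral_congr_ae (Eventually.of_forall fun x => ?_)
    simp only [Kernel.prod_apply]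
    exact integral_prod_mul u v
  have hinv' : ∀ u, IsBddMeas u → ∫ x, ∫ y, u y ∂P x ∂π = ∫ x, u x ∂π := by
    intro u hu
    rw [← integral_measure_comp _ _ hu, hinv]
  have h1 : ∀ u, IsBddMeas u → ∫ p, u p.1 ∂Γ = ∫ x, u x ∂π := by
    intro u hu
    simpa [hinv' u hu] using hprod u (fun _ => 1) hu (isBddMeas_const 1)
  have h2 : ∀ u, IsBddMeas u → ∫ p, u p.2 ∂Γ = ∫ x, u x ∂π := by
    intro u hu
    simpa [hinv' u hu] using hprod (fun _ => 1) u (isBddMeas_const 1) hu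
  have hΓ : ∀ S, MeasurableSet S → π.real S ≤ 1 / 2 → φ * π.real S ≤ Γ.real (S ×ˢ Sᶜ) := by
    intro S hS hhalf
    refine (hflow S hS hhalf).trans (le_of_eq ?_)
    have := hprod _ _ (isBddMeas_indicator hS) (isBddMeas_indicator hS.compl)
    simp only [integral_indicator_eq_real _ hS, integral_indicator_eq_real _ hS.compl,
      probReal_compl_eq_one_sub hS] at this
    rw [← this, ← integral_indicator_eq_real _ (hS.prod hS.compl)]
    congr with p
    by_cases hp1 : p.1 ∈ S <;> by_cases hp2 : p.2 ∈ S <;> simp [hp1, hp2]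
  have hch := cheeger_inequality hφ h1 h2 hΓ hf hmean
  have hsq := hf.pow 2
  have hf1 : IsBddMeas (fun p : α × α => f p.1 ^ 2) := hsq.comp measurable_fst
  have hf2 : IsBddMeas (fun p : α × α => f p.2 ^ 2) := hsq.comp measurable_snd
  have hf12 : IsBddMeas (fun p : α × α => f p.1 * f p.2) :=
    (hf.comp measurable_fst).mul (hf.comp measurable_snd)
  have hexp : ∫ p, (f p.1 - f p.2) ^ 2 ∂Γ =
      2 * ∫ x, f x ^ 2 ∂π - 2 * ∫ x, (∫ y, f y ∂P x) ^ 2 ∂π := by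
    calc ∫ p, (f p.1 - f p.2) ^ 2 ∂Γ
        = ∫ p, (f p.1 ^ 2 + f p.2 ^ 2 - 2 * (f p.1 * f p.2)) ∂Γ := by
          congr with p
          ring
      _ = 2 * ∫ x, f x ^ 2 ∂π - 2 * ∫ x, (∫ y, f y ∂P x) ^ 2 ∂π := by
          rw [integral_sub ((hf1.add hf2).integrable _)
            (((isBddMeas_const (α := α × α) 2).mul hf12).integrable _),
            integral_add (hf1.integrable _) (hf2.integrable _), integral_const_mul,
            h1 _ hsq, h2 _ hsq, hprod f f hf hf]
          simp only [sq]
          ring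
  linarith

theorem isMarkovKernel_pow (n : ℕ) : IsMarkovKernel (P ^ n) := by
  induction n with
  | zero => rw [pow_zero]; exact inferInstanceAs (IsMarkovKernel Kernel.id)
  | succ n ih => rw [pow_succ]; exact inferInstanceAs (IsMarkovKernel ((P ^ n) ∘ₖ P))

/-- The variance of `1_S` starts at `π(S) (1 - π(S)) ≤ 1/4` and contracts at every step, since
stationarity keeps the mean at `π(S)`. -/
theorem integral_pow_sub_sq_le (hinv : P ∘ₘ π = π) (hφ : 0 < φ) (hφ1 : φ ≤ 1)
    (hflow : ∀ S, MeasurableSet S → π.real S ≤ 1 / 2 →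
      φ * π.real S ≤ ∫ x, (P x).real S * (1 - (P x).real S) ∂π)
    {S : Set α} (hS : MeasurableSet S) (n : ℕ) :
    ∫ x, (((P ^ n) x).real S - π.real S) ^ 2 ∂π ≤ (1 - φ ^ 2 / 8) ^ n / 4 := by
  have hind := isBddMeas_indicator hS
  have hc := isBddMeas_const (α := α) (π.real S)
  have hmeas : ∀ n, IsBddMeas (fun x => ((P ^ n) x).real S) := by
    intro n
    have := isMarkovKernel_pow (P := P) n
    simpa only [integral_indicator_eq_real _ hS] using hind.integral_kernel (P ^ n)
  have hsucc : ∀ n x, ((P ^ (n + 1)) x).real S = ∫ y, ((P ^ n) y).real S ∂P x := by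
    intro n x
    have := isMarkovKernel_pow (P := P) n
    simp only [← integral_indicator_eq_real _ hS]
    rw [pow_succ]
    exact integral_kernel_comp P (P ^ n) hind x
  have h0 : ∀ x, ((P ^ 0) x).real S = S.indicator (fun _ => (1 : ℝ)) x := by
    intro x
    have h : P ^ 0 = Kernel.id := rfl
    rw [h, ← integral_indicator_eq_real _ hS, Kernel.id_apply,
      integral_dirac' _ _ hind.1.stronglyMeasurable]
  have hmean : ∀ n, ∫ x, ((P ^ n) x).real S ∂π = π.real S := by
    intro n
    induction n with
    | zero =>
      simp only [h0]
      exact integral_indicator_eq_real _ hS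
    | succ n ih =>
      simp only [hsucc]
      rw [← integral_measure_comp _ _ (hmeas n), hinv, ih]
  induction n with
  | zero =>
    have hval : ∫ x, (((P ^ 0) x).real S - π.real S) ^ 2 ∂π = π.real S - π.real S ^ 2 := by
      have hcm := (isBddMeas_const (α := α) (1 - 2 * π.real S)).mul hind
      calc ∫ x, (((P ^ 0) x).real S - π.real S) ^ 2 ∂π
          = ∫ x, ((1 - 2 * π.real S) * S.indicator (fun _ => (1 : ℝ)) x + π.real S ^ 2) ∂π := by
            congr with x
            rw [h0]
            by_cases hx : x ∈ S
            · simp only [Set.indicator_of_mem hx]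
              ring
            · simp only [Set.indicator_of_notMem hx]
              ring
        _ = π.real S - π.real S ^ 2 := by
            rw [integral_add (hcm.integrable _) (integrable_const _), integral_const_mul,
              integral_indicator_eq_real _ hS]
            simp only [integral_const, smul_eq_mul, probReal_univ, one_mul]
            ring
    rw [hval, pow_zero]
    nlinarith [sq_nonneg (π.real S - 1 / 2)]
  | succ n ih =>
    have hstep : ∀ x, ((P ^ (n + 1)) x).real S - π.real S =
        ∫ y, (((P ^ n) y).real S - π.real S) ∂P x := by
      intro x
      rw [integral_sub ((hmeas n).integrable _) (integrable_const _), hsucc]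
      simp
    have hle := integral_kernel_sq_le hinv hφ hflow ((hmeas n).sub hc) (by
      rw [integral_sub ((hmeas n).integrable _) (integrable_const _), hmean]
      simp)
    simp only [hstep]
    refine hle.trans ?_
    have hρ : 0 ≤ 1 - φ ^ 2 / 8 := by nlinarith
    calc (1 - φ ^ 2 / 8) * ∫ x, (((P ^ n) x).real S - π.real S) ^ 2 ∂π
        ≤ (1 - φ ^ 2 / 8) * ((1 - φ ^ 2 / 8) ^ n / 4) := by gcongr
      _ = (1 - φ ^ 2 / 8) ^ (n + 1) / 4 := by ring

theorem IsWarmStart.integral_le {μ : Measure α} [IsProbabilityMeasure μ] {Ω : ℝ} (hΩ : 0 ≤ Ω)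
    (h : IsWarmStart π μ Ω) {f : α → ℝ} (hf : IsBddMeas f) (hf0 : ∀ x, 0 ≤ f x) :
    ∫ x, f x ∂μ ≤ Ω * ∫ x, f x ∂π := by
  have hle : μ ≤ ENNReal.ofReal Ω • π := by
    refine Measure.le_iff.2 fun S hS => ?_
    have h1 : μ S / π S ≤ ENNReal.ofReal Ω :=
      (le_iSup₂ (f := fun (S : Set α) (_ : MeasurableSet S) => μ S / π S) S hS).trans h
    rwa [ENNReal.div_le_iff_le_mul (Or.inr ENNReal.ofReal_ne_top)
      (Or.inl (measure_ne_top _ _))] at h1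
  calc ∫ x, f x ∂μ ≤ ∫ x, f x ∂(ENNReal.ofReal Ω • π) :=
        integral_mono_measure hle (Eventually.of_forall hf0)
          ((hf.integrable π).smul_measure ENNReal.ofReal_ne_top)
    _ = Ω * ∫ x, f x ∂π := by
        rw [integral_smul_measure, ENNReal.toReal_ofReal hΩ, smul_eq_mul]

/-- Jensen's inequality passes to second moments under `μ`, and warmness then replaces `μ` by `Ω π`.
-/
theorem tvDist_pow_le (hinv : P ∘ₘ π = π) (hφ : 0 < φ) (hφ1 : φ ≤ 1)
    (hflow : ∀ S, MeasurableSet S → π.real S ≤ 1 / 2 →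
      φ * π.real S ≤ ∫ x, (P x).real S * (1 - (P x).real S) ∂π)
    {μ : Measure α} [IsProbabilityMeasure μ] {Ω : ℝ} (hΩ : 0 ≤ Ω) (hwarm : IsWarmStart π μ Ω)
    (n : ℕ) : tvDist ((P ^ n) ∘ₘ μ) π ≤ √(Ω * ((1 - φ ^ 2 / 8) ^ n / 4)) := by
  have := isMarkovKernel_pow (P := P) n
  have : Nonempty {S : Set α // MeasurableSet S} := ⟨⟨∅, MeasurableSet.empty⟩⟩
  refine ciSup_le fun ⟨S, hS⟩ => ?_
  have hind := isBddMeas_indicator hS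
  have hg : IsBddMeas (fun x => ((P ^ n) x).real S) := by
    simpa only [integral_indicator_eq_real _ hS] using hind.integral_kernel (P ^ n)
  have hf := hg.sub (isBddMeas_const (α := α) (π.real S))
  set f : α → ℝ := fun x => ((P ^ n) x).real S - π.real S
  have hval : ((P ^ n) ∘ₘ μ).real S - π.real S = ∫ x, f x ∂μ := by
    rw [integral_sub (hg.integrable _) (integrable_const _), ← integral_indicator_eq_real _ hS,
      integral_measure_comp _ _ hind]
    simp only [integral_indicator_eq_real _ hS]
    simp
  have hjensen : (∫ x, f x ∂μ) ^ 2 ≤ ∫ x, f x ^ 2 ∂μ := by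
    set a := ∫ x, f x ∂μ with ha
    have hcm := (isBddMeas_const (α := α) (2 * a)).mul hf
    have h0 : 0 ≤ ∫ x, (f x ^ 2 - 2 * a * f x + a ^ 2) ∂μ :=
      integral_nonneg fun x => by
        show 0 ≤ f x ^ 2 - 2 * a * f x + a ^ 2
        nlinarith [sq_nonneg (f x - a)]
    rw [integral_add (((hf.pow 2).sub hcm).integrable _) (integrable_const _),
      integral_sub ((hf.pow 2).integrable _) (hcm.integrable _), integral_const_mul, ← ha] at h0
    simp only [integral_const, smul_eq_mul, probReal_univ, one_mul] at h0
    linarith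
  rw [hval]
  refine Real.abs_le_sqrt (hjensen.trans ?_)
  refine (hwarm.integral_le hΩ (hf.pow 2) fun x => sq_nonneg _).trans ?_
  exact mul_le_mul_of_nonneg_left (integral_pow_sub_sq_le hinv hφ hφ1 hflow hS n) hΩ

theorem mixingTime_le (hinv : P ∘ₘ π = π) (hφ : 0 < φ) (hφ1 : φ ≤ 1)
    (hflow : ∀ S, MeasurableSet S → π.real S ≤ 1 / 2 →
      φ * π.real S ≤ ∫ x, (P x).real S * (1 - (P x).real S) ∂π)
    {μ : Measure α} [IsProbabilityMeasure μ] {Ω ζ : ℝ} (hΩ : 0 < Ω) (hwarm : IsWarmStart π μ Ω)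
    (hζ : 0 < ζ) (hζ' : ζ ≤ √Ω) :
    (mixingTime π μ P ζ : ℝ≥0∞) ≤ ENNReal.ofReal (16 / φ ^ 2 * Real.log (√Ω / ζ)) := by
  set L := Real.log (√Ω / ζ) with hL
  have hL0 : 0 ≤ L := Real.log_nonneg ((one_le_div hζ).2 hζ')
  set T := 16 / φ ^ 2 * L with hT
  have hT0 : 0 ≤ T := by positivity
  -- Rounding down costs a factor of at most `e`, absorbed by the `1/4` of the variance bound. An
  -- additive `1` would be fatal at `ζ = √Ω`, where the bound is `0`.
  set n := ⌊T⌋₊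
  have hn : (n : ℝ) ≤ T := Nat.floor_le hT0
  have hn' : T < n + 1 := Nat.lt_floor_add_one T
  have htv : tvDist ((P ^ n) ∘ₘ μ) π ≤ ζ := by
    refine (tvDist_pow_le hinv hφ hφ1 hflow hΩ.le hwarm n).trans (Real.sqrt_le_iff.2 ⟨hζ.le, ?_⟩)
    have hφ2 : φ ^ 2 ≤ 1 := pow_le_one₀ hφ.le hφ1
    have hρ : (1 - φ ^ 2 / 8) ^ n ≤ Real.exp (1 - 2 * L) := by
      calc (1 - φ ^ 2 / 8) ^ n ≤ Real.exp (-(φ ^ 2 / 8)) ^ n := by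
            gcongr
            · nlinarith
            · linarith [Real.add_one_le_exp (-(φ ^ 2 / 8))]
        _ = Real.exp (n * -(φ ^ 2 / 8)) := (Real.exp_nat_mul _ _).symm
        _ ≤ Real.exp (1 - 2 * L) := by
            rw [Real.exp_le_exp]
            have e : T * φ ^ 2 = 16 * L := by
              rw [hT]
              field_simp
            have := mul_le_mul_of_nonneg_right hn'.le (sq_nonneg φ)
            nlinarith
    have hexp : Real.exp (1 - 2 * L) = Real.exp 1 * (ζ ^ 2 / Ω) := by
      have h2L : Real.exp L = √Ω / ζ := by
        rw [hL, Real.exp_log]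
        have := Real.sqrt_pos.2 hΩ
        positivity
      rw [Real.exp_sub, two_mul, Real.exp_add, h2L, div_mul_div_comm, Real.mul_self_sqrt hΩ.le]
      field_simp
    have he : Real.exp 1 ≤ 4 := by linarith [Real.exp_one_lt_d9]
    rw [hexp] at hρ
    calc Ω * ((1 - φ ^ 2 / 8) ^ n / 4) ≤ Ω * (Real.exp 1 * (ζ ^ 2 / Ω) / 4) := by gcongr
      _ = Real.exp 1 / 4 * ζ ^ 2 := by field_simp
      _ ≤ 1 * ζ ^ 2 := by
          gcongr
          linarith
      _ = ζ ^ 2 := one_mul _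
  have hmix : mixingTime π μ P ζ ≤ (n : ℕ∞) := iInf₂_le n htv
  calc (mixingTime π μ P ζ : ℝ≥0∞) ≤ ((n : ℕ∞) : ℝ≥0∞) := ENat.toENNReal_mono hmix
    _ = ENNReal.ofReal n := by simp
    _ ≤ ENNReal.ofReal T := ENNReal.ofReal_le_ofReal hn

end Mixing

end GibbsSampler

/-! ### Assembly of the constants. -/

theorem theorem4 :
    ∃ c K : ℝ, 0 < c ∧ 0 < K ∧
      ∀ (d : ℕ) (_hd : 1 ≤ d)
        (π : Measure (GibbsSampler.Space d)) (_hπ : IsProbabilityMeasure π)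
        (κ : (k : Fin d) → Kernel (GibbsSampler.SpaceDrop k) ℝ)
        (_hκ : ∀ k, IsMarkovKernel (κ k))
        (_hcond : GibbsSampler.IsConditionalFamily π κ)
        (q C M β : ℝ) (_hq : 1 ≤ q) (_hC : 0 < C) (_hM : 0 < M) (_hβ : 0 < β) (_hβ' : β ≤ 1)
        (_hPI : GibbsSampler.PoincareInequality π q C)
        (_hTV : GibbsSampler.TVContinuous κ M β),
        ENNReal.ofReal (c * min 1 (C / (M * d) ^ (q / β))) ≤
            GibbsSampler.conductance π (GibbsSampler.systematicScan κ) ∧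
          ∀ (Ω ζ : ℝ) (μ : Measure (GibbsSampler.Space d)) (_hμ : IsProbabilityMeasure μ)
            (_hΩ : 0 < Ω) (_hwarm : GibbsSampler.IsWarmStart π μ Ω)
            (_hζ : 0 < ζ) (_hζ' : ζ ≤ √Ω),
            (GibbsSampler.mixingTime π μ (GibbsSampler.systematicScan κ) ζ : ℝ≥0∞) ≤
              ENNReal.ofReal
                (K * max 1 ((M * d) ^ (2 * q / β) / C ^ 2) * Real.log (√Ω / ζ)) := by
  -- The flow bound gives `φ = min 1 a / B`. Halving it yields `c = 1/(2B)`, and `16 / φ²` yields `K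
  -- = 16 B²`.
  set B : ℝ := 3 * (4 / (Real.exp (-9) / 2)) with hB
  have hBpos : 0 < B := by positivity
  have hB1 : 1 ≤ B := by
    have := GibbsSampler.exp_neg_nine_le
    have hexp := Real.exp_pos (-9)
    rw [hB, ← mul_div_assoc, one_le_div (by positivity)]
    linarith
  refine ⟨1 / (2 * B), 16 * B ^ 2, by positivity, by positivity, ?_⟩
  intro d hd π hπ κ hκ hcond q C M β hq hC hM hβ hβ' hPI hTV
  have hd0 : (0 : ℝ) < d := by exact_mod_cast hd
  set a : ℝ := C / (M * d) ^ (q / β) with ha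
  have ha0 : 0 < a := by positivity
  have hscale : C * GibbsSampler.mixingScale M β d ^ q = a := by
    rw [GibbsSampler.mixingScale_rpow hM hd, ha]
    exact (div_eq_mul_inv _ _).symm
  have hmk : IsMarkovKernel (GibbsSampler.systematicScan κ) := by
    rw [GibbsSampler.systematicScan_eq_scan]
    exact GibbsSampler.isMarkovKernel_scan κ _
  have hinv : GibbsSampler.systematicScan κ ∘ₘ π = π := by
    rw [GibbsSampler.systematicScan_eq_scan]
    exact GibbsSampler.scan_comp_measure κ hcond _
  have hmin0 : 0 < min 1 a := lt_min one_pos ha0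
  set φ : ℝ := min 1 a / B with hφdef
  have hφ : 0 < φ := by positivity
  have hφ1 : φ ≤ 1 := by
    rw [hφdef, div_le_one hBpos]
    exact (min_le_left _ _).trans hB1
  have hflow : ∀ S, MeasurableSet S → π.real S ≤ 1 / 2 → φ * π.real S ≤
      ∫ x, (GibbsSampler.systematicScan κ x).real S *
        (1 - (GibbsSampler.systematicScan κ x).real S) ∂π := by
    intro S hS hhalf
    have h := GibbsSampler.systematicScan_flow_lower_bound hd κ hcond hq hC hM hβ hβ' hPI hTV
      (GibbsSampler.isBddMeas_indicator hS).1 (GibbsSampler.indicator_mem_Icc S)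
      (by rwa [GibbsSampler.integral_indicator_eq_real _ hS])
    simp only [GibbsSampler.integral_indicator_eq_real _ hS, hscale, ← hB] at h
    rw [hφdef, div_mul_eq_mul_div, div_le_iff₀ hBpos]
    linarith
  refine ⟨?_, ?_⟩
  · have h := GibbsSampler.le_conductance_of_flow π _ hinv hflow
    refine le_trans (le_of_eq ?_) h
    congr 1
    rw [hφdef]
    field_simp
  · intro Ω ζ μ hμ hΩ hwarm hζ hζ'
    refine (GibbsSampler.mixingTime_le hinv hφ hφ1 hflow hΩ hwarm hζ hζ').trans (le_of_eq ?_)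
    have hpow : (M * d) ^ (2 * q / β) / C ^ 2 = 1 / a ^ 2 := by
      have : (M * d : ℝ) ^ (2 * q / β) = ((M * d) ^ (q / β)) ^ 2 := by
        rw [← Real.rpow_natCast, ← Real.rpow_mul (by positivity)]
        congr 1
        push_cast
        ring
      rw [this, ha]
      field_simp
    have hmax : max 1 (1 / a ^ 2) = 1 / min 1 a ^ 2 := by
      rcases le_total 1 a with h | h
      · rw [min_eq_left h, max_eq_left]
        · norm_num
        · rw [div_le_one (by positivity)]
          exact one_le_pow₀ h
      · rw [min_eq_right h, max_eq_right]
        rw [one_le_div (by positivity)]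
        exact pow_le_one₀ ha0.le h
    rw [hpow, hmax, hφdef]
    congr 2
    field_simp
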